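/- Consider four point vortices in the plane at positions $z=(z_1,z_2,z_3,z_4)\in(\mathbb{R}^2)^4$ with circulations $\Gamma_1=\Gamma_2=1$ and $\Gamma_3=\Gamma_4=m$. Let $H(z)=-\sum_{i<j}\Gamma_i\Gamma_j\ln\|z_i-z_j\|$ be the Hamiltonian, let $c=\frac{1}{\Gamma}\sum_i\Gamma_i z_i$ with $\Gamma=\sum_i\Gamma_i$ be the center of vorticity, and let $I(z)=\sum_i\Gamma_i\|z_i-c\|^2$ be the angular impulse. Let $\mathcal{N}=\{z\in\mathbb{R}^8 : c=0,\ I(z)=1\}$, let $\Delta=\{z\in\mathbb{R}^8 : z_i=z_j \text{ for some } i\neq j\}$, and let $\mathcal{M}=(\mathcal{N}\setminus\Delta)/\mathrm{SO}(2)$ be the quotient by simultaneous rotation of all vortices, which is a smooth $4$-dimensional manifold. Then, for each $m$ with $0<m<1$, the function that $H$ induces on $\mathcal{M}$ is a Morse function: it is smooth, and its Hessian is nondegenerate at every critical point. -/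

import Mathlib

open scoped Manifold ContDiff

noncomputable section

namespace Vortex

/-- Positive circulations `Γ₁, …, Γₙ`. -/
structure Circulations (n : ℕ) where
  /-- The circulation of each vortex. -/
  val : Fin n → ℝ
  pos : ∀ i, 0 < val i

/-- The circulations `(1, 1, m, m)`. -/
def pairs (m : ℝ) (hm : 0 < m) : Circulations 4 where
  val := ![1, 1, m, m]
  pos := by intro i; fin_cases i <;> simp [hm]

section Basic

variable {n : ℕ} (Γ : Circulations n)

/-- The Hamiltonian `H(z) = -∑_{i<j} Γᵢ Γⱼ ln ‖zᵢ - zⱼ‖`; the plane is identified with `ℂ`. -/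
def hamiltonian (z : Fin n → ℂ) : ℝ :=
  -∑ i, ∑ j ∈ Finset.Ioi i, Γ.val i * Γ.val j * Real.log ‖z i - z j‖

/-- The center of vorticity. -/
def center (z : Fin n → ℂ) : ℂ :=
  ((∑ i, Γ.val i : ℝ) : ℂ)⁻¹ * ∑ i, (Γ.val i : ℂ) * z i

/-- The angular impulse with respect to the center of vorticity. -/
def impulse (z : Fin n → ℂ) : ℝ :=
  ∑ i, Γ.val i * ‖z i - center Γ z‖ ^ 2

/-- The normalized configuration space `𝒩 = {z : c = 0, I(z) = 1}`. -/
def normalizedSpace : Set (Fin n → ℂ) :=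
  {z | center Γ z = 0 ∧ impulse Γ z = 1}

/-- The collision set `Δ`. -/
def collisionSet (n : ℕ) : Set (Fin n → ℂ) :=
  {z | ∃ i j, i ≠ j ∧ z i = z j}

/-- The space `𝒩 - Δ`, with the subspace topology. -/
abbrev ConfSpace : Type := ↥(normalizedSpace Γ \ collisionSet n)

theorem center_smul (a : ℂ) (z : Fin n → ℂ) :
    center Γ (fun i => a * z i) = a * center Γ z := by
  simp only [center, Finset.mul_sum]
  exact Finset.sum_congr rfl fun i _ => by ring

theorem impulse_smul (a : ℂ) (z : Fin n → ℂ) :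
    impulse Γ (fun i => a * z i) = ‖a‖ ^ 2 * impulse Γ z := by
  simp only [impulse, center_smul, ← mul_sub, norm_mul, Finset.mul_sum]
  exact Finset.sum_congr rfl fun i _ => by ring

/-- `SO(2)`, realized as the unit circle of `ℂ`, acts on `𝒩 - Δ` by rotating all vortices. -/
instance : MulAction Circle (ConfSpace Γ) where
  smul g z := ⟨fun i => (g : ℂ) * z.1 i, by
    obtain ⟨z, ⟨hc, hI⟩, hΔ⟩ := z
    refine ⟨⟨?_, ?_⟩, ?_⟩
    · rw [center_smul, hc, mul_zero]
    · rw [impulse_smul, hI, Circle.norm_coe]; norm_num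
    · rintro ⟨i, j, hij, h⟩
      exact hΔ ⟨i, j, hij, mul_left_cancel₀ g.coe_ne_zero h⟩⟩
  one_smul z := Subtype.ext (funext fun i => by
    change ((1 : Circle) : ℂ) * z.1 i = z.1 i
    simp)
  mul_smul g h z := Subtype.ext (funext fun i => by
    change ((g * h : Circle) : ℂ) * z.1 i = (g : ℂ) * ((h : ℂ) * z.1 i)
    rw [Circle.coe_mul, mul_assoc])

theorem smul_apply (g : Circle) (z : ConfSpace Γ) (i : Fin n) :
    (g • z).1 i = (g : ℂ) * z.1 i := rfl

/-- The quotient space `ℳ = (𝒩 - Δ) / SO(2)`, with the quotient topology. -/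
def Reduced : Type := MulAction.orbitRel.Quotient Circle (ConfSpace Γ)

instance : TopologicalSpace (Reduced Γ) :=
  inferInstanceAs (TopologicalSpace (Quotient (MulAction.orbitRel Circle (ConfSpace Γ))))

/-- The projection `𝒩 - Δ → ℳ`. -/
def proj (z : ConfSpace Γ) : Reduced Γ :=
  Quotient.mk (MulAction.orbitRel Circle (ConfSpace Γ)) z

theorem continuous_proj : Continuous (proj Γ) := continuous_quotient_mk'

theorem proj_surjective : Function.Surjective (proj Γ) := Quotient.mk_surjective

/-- The function induced by the Hamiltonian on the quotient `ℳ`. -/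
def reducedHamiltonian : Reduced Γ → ℝ :=
  Quotient.lift (fun z : ConfSpace Γ => hamiltonian Γ z.1) (by
    rintro _ z ⟨g, rfl⟩
    simp only [hamiltonian, smul_apply, ← mul_sub, norm_mul, Circle.norm_coe, one_mul])

end Basic

section SmoothStructure

/-! ### The smooth structure of the quotient

Away from collisions the shape coordinates `wⱼ = (zⱼ - z₁)/(z₂ - z₁)`, `3 ≤ j ≤ n`, form a
global chart of `ℳ`. They are smooth in `z` and have a smooth section `rep`
(`contDiffOn_shapeCoord`, `contDiff_rep`, `shapeCoord_rep`),
so this is the smooth structure for which the projection `𝒩 - Δ → ℳ` is a submersion. -/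

variable {k : ℕ} (Γ : Circulations (k + 2))

/-- The configuration `(0, 1, w₃, …, wₙ)`. -/
def frame (w : Fin k → ℂ) : Fin (k + 2) → ℂ :=
  Matrix.vecCons 0 (Matrix.vecCons 1 w)

/-- The shape coordinates of a configuration. -/
def shapeCoord (z : Fin (k + 2) → ℂ) (j : Fin k) : ℂ :=
  (z j.succ.succ - z 0) / (z 1 - z 0)

/-- The collision-free shapes. -/
def shapes (k : ℕ) : Set (Fin k → ℂ) :=
  {w | frame w ∉ collisionSet (k + 2)}

/-- The configuration `(0, 1, w₃, …, wₙ)`, translated and scaled to lie in `𝒩`. -/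
def rep (w : Fin k → ℂ) (i : Fin (k + 2)) : ℂ :=
  (((Real.sqrt (impulse Γ (frame w)))⁻¹ : ℝ) : ℂ) * (frame w i - center Γ (frame w))

theorem sum_pos' : 0 < ∑ i, Γ.val i :=
  Finset.sum_pos (fun i _ => Γ.pos i) Finset.univ_nonempty

theorem center_affine (a b : ℂ) (z : Fin (k + 2) → ℂ) :
    center Γ (fun i => a * z i + b) = a * center Γ z + b := by
  have h : ((∑ i, Γ.val i : ℝ) : ℂ) ≠ 0 := by exact_mod_cast (sum_pos' Γ).ne'
  have h1 : ∑ i, (Γ.val i : ℂ) * (a * z i + b)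
      = a * (∑ i, (Γ.val i : ℂ) * z i) + ((∑ i, Γ.val i : ℝ) : ℂ) * b := by
    push_cast
    rw [Finset.mul_sum, Finset.sum_mul, ← Finset.sum_add_distrib]
    exact Finset.sum_congr rfl fun i _ => by ring
  rw [center, center, h1]
  field_simp

theorem impulse_affine (a b : ℂ) (z : Fin (k + 2) → ℂ) :
    impulse Γ (fun i => a * z i + b) = ‖a‖ ^ 2 * impulse Γ z := by
  simp only [impulse, center_affine, add_sub_add_right_eq_sub, ← mul_sub, norm_mul,
    Finset.mul_sum]
  exact Finset.sum_congr rfl fun i _ => by ring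

theorem impulse_frame_pos (w : Fin k → ℂ) : 0 < impulse Γ (frame w) := by
  have hnn : ∀ i, 0 ≤ Γ.val i * ‖frame w i - center Γ (frame w)‖ ^ 2 := fun i =>
    mul_nonneg (Γ.pos i).le (sq_nonneg _)
  refine lt_of_le_of_ne (Finset.sum_nonneg fun i _ => hnn i) fun h => ?_
  have h0 := (Finset.sum_eq_zero_iff_of_nonneg fun i _ => hnn i).1 h.symm
  have key : ∀ i, frame w i = center Γ (frame w) := fun i => by
    have := h0 i (Finset.mem_univ i)
    simpa [(Γ.pos i).ne', sub_eq_zero] using this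
  have h01 : frame w 0 = frame w 1 := (key 0).trans (key 1).symm
  simp [frame] at h01

theorem sqrt_impulse_pos (w : Fin k → ℂ) : 0 < Real.sqrt (impulse Γ (frame w)) :=
  Real.sqrt_pos.2 (impulse_frame_pos Γ w)

theorem rep_mem {w : Fin k → ℂ} (hw : w ∈ shapes k) :
    rep Γ w ∈ normalizedSpace Γ \ collisionSet (k + 2) := by
  have hs := sqrt_impulse_pos Γ w
  have hI := Real.sq_sqrt (impulse_frame_pos Γ w).le
  have hrep : rep Γ w = fun i =>
      (((Real.sqrt (impulse Γ (frame w)))⁻¹ : ℝ) : ℂ) * frame w i +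
        -((((Real.sqrt (impulse Γ (frame w)))⁻¹ : ℝ) : ℂ) * center Γ (frame w)) := by
    funext i; rw [rep]; ring
  refine ⟨⟨?_, ?_⟩, ?_⟩
  · rw [hrep, center_affine]; ring
  · rw [hrep, impulse_affine, Complex.norm_real, Real.norm_eq_abs, sq_abs, inv_pow, hI]
    exact inv_mul_cancel₀ (impulse_frame_pos Γ w).ne'
  · rintro ⟨i, j, hij, h⟩
    refine hw ⟨i, j, hij, ?_⟩
    have hne : (((Real.sqrt (impulse Γ (frame w)))⁻¹ : ℝ) : ℂ) ≠ 0 := by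
      exact_mod_cast (inv_pos.2 hs).ne'
    simpa [rep] using mul_left_cancel₀ hne h

theorem shapeCoord_rep (w : Fin k → ℂ) : shapeCoord (rep Γ w) = w := by
  have hne : (((Real.sqrt (impulse Γ (frame w)))⁻¹ : ℝ) : ℂ) ≠ 0 := by
    exact_mod_cast (inv_pos.2 (sqrt_impulse_pos Γ w)).ne'
  funext j
  have h0 : frame w 0 = 0 := rfl
  have h1 : frame w 1 = 1 := rfl
  have hj : frame w j.succ.succ = w j := rfl
  simp only [shapeCoord, rep, ← mul_sub, sub_sub_sub_cancel_right, h0, h1, hj, sub_zero, mul_one]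
  exact mul_div_cancel_left₀ _ hne

theorem eq_affine_frame {z : Fin (k + 2) → ℂ} (hz : z 1 - z 0 ≠ 0) :
    z = fun i => (z 1 - z 0) * frame (shapeCoord z) i + z 0 := by
  funext i
  refine Fin.cases ?_ (fun i => Fin.cases ?_ (fun j => ?_) i) i
  · change z 0 = (z 1 - z 0) * 0 + z 0
    ring
  · change z 1 = (z 1 - z 0) * 1 + z 0
    ring
  · change z j.succ.succ = (z 1 - z 0) * ((z j.succ.succ - z 0) / (z 1 - z 0)) + z 0
    rw [mul_div_cancel₀ _ hz]
    ring

theorem sub_ne_zero_of_conf (z : ConfSpace Γ) : z.1 1 - z.1 0 ≠ 0 := fun h =>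
  z.2.2 ⟨1, 0, by simp, sub_eq_zero.1 h⟩

theorem shapeCoord_mem (z : ConfSpace Γ) : shapeCoord z.1 ∈ shapes k := by
  rintro ⟨i, j, hij, h⟩
  refine z.2.2 ⟨i, j, hij, ?_⟩
  rw [eq_affine_frame (sub_ne_zero_of_conf Γ z)]
  simp only [h]

theorem shapeCoord_smul (g : Circle) (z : ConfSpace Γ) :
    shapeCoord (g • z).1 = shapeCoord z.1 := by
  funext j
  simp only [shapeCoord, smul_apply, ← mul_sub]
  exact mul_div_mul_left _ _ g.coe_ne_zero

theorem proj_rep_shapeCoord (z : ConfSpace Γ) :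
    proj Γ ⟨rep Γ (shapeCoord z.1), rep_mem Γ (shapeCoord_mem Γ z)⟩ = proj Γ z := by
  have hne := sub_ne_zero_of_conf Γ z
  have haff := eq_affine_frame hne
  set a := z.1 1 - z.1 0 with ha
  set F := frame (shapeCoord z.1) with hF
  have hc : a * center Γ F + z.1 0 = 0 := by
    rw [← center_affine, ← haff]; exact z.2.1.1
  have hI : ‖a‖ ^ 2 * impulse Γ F = 1 := by
    rw [← impulse_affine Γ a (z.1 0), ← haff]; exact z.2.1.2
  have hs : ‖a‖ = (Real.sqrt (impulse Γ F))⁻¹ := by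
    refine eq_inv_of_mul_eq_one_left ?_
    have h2 : (‖a‖ * Real.sqrt (impulse Γ F)) ^ 2 = 1 := by
      rw [mul_pow, Real.sq_sqrt (impulse_frame_pos Γ _).le, hI]
    exact (pow_eq_one_iff_of_nonneg (by positivity) two_ne_zero).1 h2
  have hna : (‖a‖ : ℂ) ≠ 0 := by exact_mod_cast (norm_pos_iff.2 hne).ne'
  have hg : ‖(‖a‖ : ℂ) / a‖ = 1 := by
    rw [norm_div, Complex.norm_real, norm_norm, div_self (norm_pos_iff.2 hne).ne']
  refine Quotient.sound ⟨⟨(‖a‖ : ℂ) / a, mem_sphere_zero_iff_norm.2 hg⟩, ?_⟩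
  refine Subtype.ext (funext fun i => ?_)
  change (‖a‖ : ℂ) / a * z.1 i = rep Γ (shapeCoord z.1) i
  rw [congrFun haff i, rep, ← hF, ← hs, eq_neg_of_add_eq_zero_right hc]
  field_simp
  ring

theorem isOpen_shapes : IsOpen (shapes k) := by
  have hcont : ∀ i, Continuous fun w : Fin k → ℂ => frame w i := fun i => by
    refine Fin.cases continuous_const (fun i => ?_) i
    exact Fin.cases continuous_const (fun j => continuous_apply j) i
  have : shapes k = ⋂ i, ⋂ j, {w | i ≠ j → frame w i ≠ frame w j} := by
    ext w; simp [shapes, collisionSet]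
  rw [this]
  refine isOpen_iInter_of_finite fun i => isOpen_iInter_of_finite fun j => ?_
  by_cases hij : i = j
  · simp [hij]
  · simpa [hij] using isOpen_ne_fun (hcont i) (hcont j)

theorem contDiff_frame (i : Fin (k + 2)) :
    ContDiff ℝ ∞ fun w : Fin k → ℂ => frame w i := by
  refine Fin.cases contDiff_const (fun i => ?_) i
  exact Fin.cases contDiff_const (fun j => contDiff_apply ℝ ℂ j) i

theorem contDiff_center_frame : ContDiff ℝ ∞ fun w : Fin k → ℂ => center Γ (frame w) :=
  contDiff_const.mul (ContDiff.sum fun i _ => contDiff_const.mul (contDiff_frame i))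

theorem contDiff_impulse_frame : ContDiff ℝ ∞ fun w : Fin k → ℂ => impulse Γ (frame w) :=
  ContDiff.sum fun i _ =>
    contDiff_const.mul (((contDiff_frame i).sub (contDiff_center_frame Γ)).norm_sq ℝ)

theorem contDiff_rep : ContDiff ℝ ∞ (rep Γ) := by
  refine contDiff_pi.2 fun i => ?_
  have h1 : ContDiff ℝ ∞ fun w : Fin k → ℂ => (Real.sqrt (impulse Γ (frame w)))⁻¹ :=
    ((contDiff_impulse_frame Γ).sqrt fun w => (impulse_frame_pos Γ w).ne').inv
      fun w => (sqrt_impulse_pos Γ w).ne'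
  exact (Complex.ofRealCLM.contDiff.comp h1).mul
    ((contDiff_frame i).sub (contDiff_center_frame Γ))

theorem contDiffOn_shapeCoord :
    ContDiffOn ℝ ∞ (shapeCoord (k := k)) {z | z 1 ≠ z 0} := by
  refine contDiffOn_pi.2 fun j => ?_
  have h : ∀ i j : Fin (k + 2), ContDiffOn ℝ ∞ (fun z : Fin (k + 2) → ℂ => z i - z j)
      {z | z 1 ≠ z 0} := fun i j =>
    ((contDiff_apply ℝ ℂ i).sub (contDiff_apply ℝ ℂ j)).contDiffOn
  simp only [shapeCoord, div_eq_mul_inv]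
  exact (h _ _).mul ((h 1 0).inv fun z hz => sub_ne_zero.2 hz)

theorem base_mem : (fun j : Fin k => ((j : ℕ) : ℂ) + 2) ∈ shapes k := by
  have h : ∀ i : Fin (k + 2),
      frame (fun j : Fin k => ((j : ℕ) : ℂ) + 2) i = ((i : ℕ) : ℂ) := fun i => by
    refine Fin.cases ?_ (fun i => Fin.cases ?_ (fun j => ?_) i) i
    · simp [frame]
    · simp [frame]
    · simp [frame]; ring
  rintro ⟨i, j, hij, he⟩
  rw [h, h] at he
  exact hij (Fin.ext (by exact_mod_cast he))

open Classical in
/-- The global chart of `ℳ` given by the shape coordinates. (The value of the inverse outside the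
target is irrelevant.) -/
def shapeChart : OpenPartialHomeomorph (Reduced Γ) (Fin k → ℂ) where
  toFun := Quotient.lift (fun z : ConfSpace Γ => shapeCoord z.1) (by
    rintro _ z ⟨g, rfl⟩
    exact shapeCoord_smul Γ g z)
  invFun w := if hw : w ∈ shapes k then proj Γ ⟨rep Γ w, rep_mem Γ hw⟩
    else proj Γ ⟨_, rep_mem Γ base_mem⟩
  source := Set.univ
  target := shapes k
  map_source' := by
    rintro x -
    obtain ⟨z, rfl⟩ := proj_surjective Γ x
    exact shapeCoord_mem Γ z
  map_target' _ _ := Set.mem_univ _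
  left_inv' := by
    rintro x -
    obtain ⟨z, rfl⟩ := proj_surjective Γ x
    change (if hw : shapeCoord z.1 ∈ shapes k then proj Γ ⟨_, rep_mem Γ hw⟩
      else proj Γ ⟨_, rep_mem Γ base_mem⟩) = proj Γ z
    rw [dif_pos (shapeCoord_mem Γ z)]
    exact proj_rep_shapeCoord Γ z
  right_inv' := by
    intro w hw
    simp only [dif_pos hw]
    exact shapeCoord_rep Γ w
  open_source := isOpen_univ
  open_target := isOpen_shapes
  continuousOn_toFun := by
    refine Continuous.continuousOn (Continuous.quotient_lift ?_ _)
    exact contDiffOn_shapeCoord.continuousOn.comp_continuous continuous_subtype_val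
      fun z => sub_ne_zero.1 (sub_ne_zero_of_conf Γ z)
  continuousOn_invFun := by
    rw [continuousOn_iff_continuous_domRestrict]
    have : Continuous fun w : shapes k => proj Γ ⟨rep Γ w.1, rep_mem Γ w.2⟩ :=
      (continuous_proj Γ).comp
        (((contDiff_rep Γ).continuous.comp continuous_subtype_val).subtype_mk _)
    convert this using 2 with w
    simp [w.2]

/-- The manifold structure on `ℳ`, of real dimension `2 k = 2 n - 4` for `n = k + 2` vortices. -/
instance : ChartedSpace (Fin k → ℂ) (Reduced Γ) :=
  (shapeChart Γ).singletonChartedSpace rfl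

instance : IsManifold 𝓘(ℝ, Fin k → ℂ) ∞ (Reduced Γ) :=
  (shapeChart Γ).isManifold_singleton rfl

end SmoothStructure

section Morse

variable {E : Type*} [NormedAddCommGroup E] [NormedSpace ℝ E] [FiniteDimensional ℝ E]
  {M : Type*} [TopologicalSpace M] [ChartedSpace E M]

/-- The matrix of second partial derivatives, as a bilinear form, of `f` in the preferred chart
at `p`. -/
def chartHessian (f : M → ℝ) (p : M) : E →L[ℝ] E →L[ℝ] ℝ :=
  fderiv ℝ (fderiv ℝ (f ∘ (extChartAt 𝓘(ℝ, E) p).symm)) (extChartAt 𝓘(ℝ, E) p p)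

/-- `p` is a critical point of `f`. -/
def IsCriticalPoint (f : M → ℝ) (p : M) : Prop :=
  mfderiv 𝓘(ℝ, E) 𝓘(ℝ, ℝ) f p = 0

/-- A Morse function: smooth, with nondegenerate Hessian at each critical point (a condition that
does not depend on the chart). -/
def IsMorse (f : M → ℝ) : Prop :=
  ContMDiff 𝓘(ℝ, E) 𝓘(ℝ, ℝ) ∞ f ∧
    ∀ p : M, IsCriticalPoint (E := E) f p →
      ∀ v : E, (∀ u : E, chartHessian f p v u = 0) → v = 0

end Morse

end Vortex

end

/-! In the global shape chart, which places the first two vortices at `0` and `1`, the induced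
function is, up to a constant, the scale-invariant energy `-∑ Γᵢ Γⱼ log rᵢⱼ + (L / 2) log J`. Its
critical points are the equilibria `∑ⱼ Cᵢⱼ (zᵢ - zⱼ) = 0` with `Cᵢⱼ = Γᵢ Γⱼ (rᵢⱼ⁻² - ν)` and `ν = L
/ J`. A vector in the kernel of the Hessian at a critical point is a first-order deformation along
which these equations persist, that is, a solution of the same equations over the dual numbers
`ℝ[ε]`. It must be shown that the `ε`-part of every such solution vanishes
(`snd_eq_zero_of_equilibrium`).

At a collinear equilibrium the tangential and normal variations decouple. The tangential equations
have positive coefficients and obey a maximum principle; the normal ones are treated by comparing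
the two vortices with the largest slope (`exists_sub_eq_mul_of_collinear`).

At a non-collinear equilibrium the matrix `C` is, off the diagonal, `κ Aᵢ Aⱼ` with `Aᵢ` the signed
areas (`exists_eq_mul_signedArea`) and `κ < 0` (`dziobek_neg`). With `aᵢ = √(-κ/ν) Aᵢ / Γᵢ` this
reads `ν rᵢⱼ² = (1 - aᵢ aⱼ)⁻¹`, and the relations between areas and distances become the polynomial
system `AreaSystem`. Differences of its equations factor: `a₁ = a₂` or a cofactor vanishes, likewise
`a₃ = a₄`. This leaves rhombi, kites and configurations with neither equality; for the last,
`trapezoid_factor` separates isosceles trapezoids from asymmetric ones. In each class the remaining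
unknowns are roots of explicit equations.

The system is algebraic, so the argument runs over `ℝ[ε]` as well as over `ℝ`, where an element with
nonzero real part is a unit. A factorization therefore lifts provided that the classes do not meet:
the other factors must have nonzero real part. This, the simplicity of the roots, and the exclusion
of spurious classes are polynomial inequalities in `m`, several of which need `m < 1`. -/

noncomputable section

namespace Vortex

/-! ### The equations for the normalized areas, over a commutative ring -/

section AreaSystem

/-- The equations satisfied by the normalized signed areas `aᵢ` of a non-collinear equilibrium with
circulations `(g, g, h, h)`; `eᵢⱼ` is the inverse of `1 - aᵢ aⱼ`. -/
structure AreaSystem {S : Type*} [CommRing S]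
    (g h a₁ a₂ a₃ a₄ e₁₂ e₁₃ e₁₄ e₂₃ e₂₄ e₃₄ t : S) : Prop where
  sum_eq : g * (a₁ + a₂) + h * (a₃ + a₄) = 0
  inv₁₂ : e₁₂ * (1 - a₁ * a₂) = 1
  inv₁₃ : e₁₃ * (1 - a₁ * a₃) = 1
  inv₁₄ : e₁₄ * (1 - a₁ * a₄) = 1
  inv₂₃ : e₂₃ * (1 - a₂ * a₃) = 1
  inv₂₄ : e₂₄ * (1 - a₂ * a₄) = 1
  inv₃₄ : e₃₄ * (1 - a₃ * a₄) = 1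
  eq₁ : g * (a₂ * e₁₂) + h * (a₃ * e₁₃ + a₄ * e₁₄) = t
  eq₂ : g * (a₁ * e₁₂) + h * (a₃ * e₂₃ + a₄ * e₂₄) = t
  eq₃ : h * (a₄ * e₃₄) + g * (a₁ * e₁₃ + a₂ * e₂₃) = t
  eq₄ : h * (a₃ * e₃₄) + g * (a₁ * e₁₄ + a₂ * e₂₄) = t

namespace AreaSystem

variable {S : Type*} [CommRing S] {g h a₁ a₂ a₃ a₄ e₁₂ e₁₃ e₁₄ e₂₃ e₂₄ e₃₄ t : S}

/-- The system is symmetric under exchange of the two pairs of vortices, so each result on the pair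
`a₁, a₂` also serves for `a₃, a₄`. -/
theorem swap (H : AreaSystem g h a₁ a₂ a₃ a₄ e₁₂ e₁₃ e₁₄ e₂₃ e₂₄ e₃₄ t) :
    AreaSystem h g a₃ a₄ a₁ a₂ e₃₄ e₁₃ e₂₃ e₁₄ e₂₄ e₁₂ t where
  sum_eq := by rw [add_comm]; exact H.sum_eq
  inv₁₂ := H.inv₃₄
  inv₁₃ := by rw [mul_comm a₃]; exact H.inv₁₃
  inv₁₄ := by rw [mul_comm a₃]; exact H.inv₂₃
  inv₂₃ := by rw [mul_comm a₄]; exact H.inv₁₄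
  inv₂₄ := by rw [mul_comm a₄]; exact H.inv₂₄
  inv₃₄ := H.inv₁₂
  eq₁ := H.eq₃
  eq₂ := H.eq₄
  eq₃ := H.eq₁
  eq₄ := H.eq₂

theorem map {S' : Type*} [CommRing S'] (f : S →+* S')
    (H : AreaSystem g h a₁ a₂ a₃ a₄ e₁₂ e₁₃ e₁₄ e₂₃ e₂₄ e₃₄ t) :
    AreaSystem (f g) (f h) (f a₁) (f a₂) (f a₃) (f a₄) (f e₁₂) (f e₁₃) (f e₁₄) (f e₂₃) (f e₂₄)
      (f e₃₄) (f t) := by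
  obtain ⟨h1, h2, h3, h4, h5, h6, h7, h8, h9, h10, h11⟩ := H
  constructor
  · simpa using congrArg f h1
  · simpa using congrArg f h2
  · simpa using congrArg f h3
  · simpa using congrArg f h4
  · simpa using congrArg f h5
  · simpa using congrArg f h6
  · simpa using congrArg f h7
  · simpa using congrArg f h8
  · simpa using congrArg f h9
  · simpa using congrArg f h10
  · simpa using congrArg f h11

/-- Since `e₁₃ - e₂₃ = (a₁ - a₂) a₃ e₁₃ e₂₃`, and similarly with index 4, every term of `eq₁ - eq₂`
contains the factor `a₁ - a₂`. -/
theorem sub_mul_eq_zero (H : AreaSystem g h a₁ a₂ a₃ a₄ e₁₂ e₁₃ e₁₄ e₂₃ e₂₄ e₃₄ t) :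
    (a₁ - a₂) * (h * (a₃ ^ 2 * (e₁₃ * e₂₃) + a₄ ^ 2 * (e₁₄ * e₂₄)) - g * e₁₂) = 0 := by
  linear_combination H.eq₁ - H.eq₂ + h * a₃ * (e₁₃ * H.inv₂₃ - e₂₃ * H.inv₁₃)
    + h * a₄ * (e₁₄ * H.inv₂₄ - e₂₄ * H.inv₁₄)

/-- The first factor equation, with the denominators cleared. -/
theorem prod_eq (H : AreaSystem g h a₁ a₂ a₃ a₄ e₁₂ e₁₃ e₁₄ e₂₃ e₂₄ e₃₄ t)
    (hK : h * (a₃ ^ 2 * (e₁₃ * e₂₃) + a₄ ^ 2 * (e₁₄ * e₂₄)) = g * e₁₂) :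
    g * ((1 - a₁ * a₃) * (1 - a₂ * a₃) * ((1 - a₁ * a₄) * (1 - a₂ * a₄))) =
      h * (1 - a₁ * a₂) * (a₃ ^ 2 * ((1 - a₁ * a₄) * (1 - a₂ * a₄)) +
        a₄ ^ 2 * ((1 - a₁ * a₃) * (1 - a₂ * a₃))) := by
  obtain ⟨-, h2, h3, h4, h5, h6, -, -, -, -, -⟩ := H
  generalize 1 - a₁ * a₃ = d13 at *
  generalize 1 - a₂ * a₃ = d23 at *
  generalize 1 - a₁ * a₄ = d14 at *
  generalize 1 - a₂ * a₄ = d24 at *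
  generalize 1 - a₁ * a₂ = d12 at *
  have e1 : e₁₃ * e₂₃ * (d13 * d23) = 1 := by linear_combination e₂₃ * d23 * h3 + h5
  have e2 : e₁₄ * e₂₄ * (d14 * d24) = 1 := by linear_combination e₂₄ * d24 * h4 + h6
  generalize e₁₃ * e₂₃ = p at *
  generalize e₁₄ * e₂₄ = q at *
  linear_combination -(d12 * d13 * d23 * d14 * d24) * hK - g * (d13 * d23 * (d14 * d24)) * h2
    + h * d12 * (a₃ ^ 2 * d14 * d24 * e1 + a₄ ^ 2 * d13 * d23 * e2)

/-- The equation that separates trapezoids from asymmetric configurations. -/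
theorem trapezoid_factor {m : S}
    (H : AreaSystem 1 m a₁ a₂ a₃ a₄ e₁₂ e₁₃ e₁₄ e₂₃ e₂₄ e₃₄ t)
    (hK : m * (a₃ ^ 2 * (e₁₃ * e₂₃) + a₄ ^ 2 * (e₁₄ * e₂₄)) = 1 * e₁₂)
    (hK' : 1 * (a₁ ^ 2 * (e₁₃ * e₁₄) + a₂ ^ 2 * (e₂₃ * e₂₄)) = m * e₃₄) :
    4 * ((a₃ + a₄) * ((1 + m * (a₃ * a₄)) * (m + a₁ * a₂))) = 0 := by
  -- This is `eq₁ + eq₂ - eq₃ - eq₄` with `e₁₂` and `m * e₃₄` replaced by means of `hK` and `hK'`,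
  -- multiplied by the four mixed denominators `1 - aᵢ aⱼ`.
  have key : (a₁ + a₂) * (m * (a₃ ^ 2 * ((1 - a₁ * a₄) * (1 - a₂ * a₄)) +
        a₄ ^ 2 * ((1 - a₁ * a₃) * (1 - a₂ * a₃))))
      + m * (a₃ * (2 - (a₁ + a₂) * a₃) * ((1 - a₁ * a₄) * (1 - a₂ * a₄))
        + a₄ * (2 - (a₁ + a₂) * a₄) * ((1 - a₁ * a₃) * (1 - a₂ * a₃)))
      - (a₃ + a₄) * (a₁ ^ 2 * ((1 - a₂ * a₃) * (1 - a₂ * a₄)) +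
        a₂ ^ 2 * ((1 - a₁ * a₃) * (1 - a₁ * a₄)))
      - (a₁ * (2 - (a₃ + a₄) * a₁) * ((1 - a₂ * a₃) * (1 - a₂ * a₄))
        + a₂ * (2 - (a₃ + a₄) * a₂) * ((1 - a₁ * a₃) * (1 - a₁ * a₄))) = 0 := by
    have hT : (a₁ + a₂) * e₁₂ + m * (a₃ * (e₁₃ + e₂₃) + a₄ * (e₁₄ + e₂₄))
        - (a₃ + a₄) * (m * e₃₄) - (a₁ * (e₁₃ + e₁₄) + a₂ * (e₂₃ + e₂₄)) = 0 := by
      linear_combination H.eq₁ + H.eq₂ - H.eq₃ - H.eq₄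
    rw [one_mul] at hK hK'
    rw [← hK, ← hK'] at hT
    have h3 := H.inv₁₃
    have h4 := H.inv₁₄
    have h5 := H.inv₂₃
    have h6 := H.inv₂₄
    have s13 : 2 - (a₁ + a₂) * a₃ = (1 - a₁ * a₃) + (1 - a₂ * a₃) := by ring
    have s14 : 2 - (a₁ + a₂) * a₄ = (1 - a₁ * a₄) + (1 - a₂ * a₄) := by ring
    have s31 : 2 - (a₃ + a₄) * a₁ = (1 - a₁ * a₃) + (1 - a₁ * a₄) := by ring
    have s32 : 2 - (a₃ + a₄) * a₂ = (1 - a₂ * a₃) + (1 - a₂ * a₄) := by ring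
    rw [s13, s14, s31, s32]
    clear s13 s14 s31 s32 hK hK' H
    generalize 1 - a₁ * a₃ = d13 at *
    generalize 1 - a₂ * a₃ = d23 at *
    generalize 1 - a₁ * a₄ = d14 at *
    generalize 1 - a₂ * a₄ = d24 at *
    have hT' := congrArg (· * (d13 * d23 * d14 * d24)) hT
    simp only [zero_mul] at hT'
    have e1 : e₁₃ * e₂₃ * (d13 * d23) = 1 := by linear_combination e₂₃ * d23 * h3 + h5
    have e2 : e₁₄ * e₂₄ * (d14 * d24) = 1 := by linear_combination e₂₄ * d24 * h4 + h6
    have e3 : e₁₃ * e₁₄ * (d13 * d14) = 1 := by linear_combination e₁₄ * d14 * h3 + h4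
    have e4 : e₂₃ * e₂₄ * (d23 * d24) = 1 := by linear_combination e₂₄ * d24 * h5 + h6
    linear_combination hT' - (a₁ + a₂) * m * (a₃ ^ 2 * d14 * d24 * e1 + a₄ ^ 2 * d13 * d23 * e2)
      - m * (a₃ * d14 * d24 * (d23 * h3 + d13 * h5) + a₄ * d13 * d23 * (d24 * h4 + d14 * h6))
      + (a₃ + a₄) * (a₁ ^ 2 * d23 * d24 * e3 + a₂ ^ 2 * d13 * d14 * e4)
      + (a₁ * d23 * d24 * (d14 * h3 + d13 * h4) + a₂ * d13 * d14 * (d24 * h5 + d23 * h6))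
  -- On the hyperplane `sum_eq` the polynomial in `key` splits into the three stated factors.
  have h1 : a₁ = -a₂ - m * (a₃ + a₄) := by linear_combination H.sum_eq
  clear hK hK' H
  subst h1
  linear_combination key

/-- For equal areas `x` of the first pair, `e₁₃ = e₂₃` and `e₁₄ = e₂₄`, so `hK` is a polynomial
relation in `x`, `a₃ + a₄` and `a₃ a₄`. The relation `sum_eq` then removes `a₃ + a₄`, so that `x²`
determines the product `a₃ a₄`. -/
theorem kite_prod {x : S} (H : AreaSystem g h x x a₃ a₄ e₁₂ e₁₃ e₁₄ e₂₃ e₂₄ e₃₄ t)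
    (hK : g * (x ^ 2 * (e₁₃ * e₁₄) + x ^ 2 * (e₂₃ * e₂₄)) = h * e₃₄) :
    h * ((1 - x * a₃) * (1 - x * a₄)) = 2 * g * x ^ 2 * (1 - a₃ * a₄) ∧
      (h + 2 * g) * x ^ 2 * (a₃ * a₄) = -h := by
  have h3 := H.inv₁₃
  have h4 := H.inv₁₄
  have h5 : e₂₃ = e₁₃ := by linear_combination e₁₃ * H.inv₂₃ - e₂₃ * H.inv₁₃
  have h6 : e₂₄ = e₁₄ := by linear_combination e₁₄ * H.inv₂₄ - e₂₄ * H.inv₁₄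
  have h7 := H.inv₃₄
  have hs := H.sum_eq
  subst h5 h6
  clear H
  have e3 : e₂₃ * e₂₄ * ((1 - x * a₃) * (1 - x * a₄)) = 1 := by
    linear_combination e₂₄ * (1 - x * a₄) * h3 + h4
  have key : h * ((1 - x * a₃) * (1 - x * a₄)) = 2 * g * x ^ 2 * (1 - a₃ * a₄) := by
    linear_combination -(1 - a₃ * a₄) * ((1 - x * a₃) * (1 - x * a₄)) * hK
      - h * ((1 - x * a₃) * (1 - x * a₄)) * h7 + 2 * g * x ^ 2 * (1 - a₃ * a₄) * e3
  exact ⟨key, by linear_combination key + x * hs⟩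

/-- The combination `eq₁ + eq₂ - eq₃ - eq₄` is the equation still unused; eliminating `a₃ + a₄` and
`a₃ a₄` from it by `kite_prod` leaves, apart from the factor `4x`, a quadratic equation for `x²`. -/
theorem kite_quadratic {x : S} (H : AreaSystem g h x x a₃ a₄ e₁₂ e₁₃ e₁₄ e₂₃ e₂₄ e₃₄ t)
    (hK : g * (x ^ 2 * (e₁₃ * e₁₄) + x ^ 2 * (e₂₃ * e₂₄)) = h * e₃₄) :
    4 * x * (g ^ 2 * x ^ 2 * (x ^ 2 * (h + 2 * g) + h) -
      (1 - x ^ 2) * (2 * g * h * (h + 2 * g) * x ^ 2 - h ^ 3)) = 0 := by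
  obtain ⟨hP, hr⟩ := H.kite_prod hK
  have h3 := H.inv₁₃
  have h4 := H.inv₁₄
  have h5 : e₂₃ = e₁₃ := by linear_combination e₁₃ * H.inv₂₃ - e₂₃ * H.inv₁₃
  have h6 : e₂₄ = e₁₄ := by linear_combination e₁₄ * H.inv₂₄ - e₂₄ * H.inv₁₄
  have h7 := H.inv₃₄
  have h2 := H.inv₁₂
  have hs := H.sum_eq
  subst h5 h6
  have hT : 2 * g * x * e₁₂ + 2 * h * (a₃ * e₂₃ + a₄ * e₂₄) - 2 * g * x * (e₂₃ + e₂₄)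
      + 2 * g * x * e₃₄ = 0 := by
    linear_combination H.eq₁ + H.eq₂ - H.eq₃ - H.eq₄ + e₃₄ * hs
  clear H hK
  have hT1 : g * x * (e₁₂ + e₃₄) * ((1 - x * a₃) * (1 - x * a₄))
      + h * (a₃ + a₄ - 2 * x * (a₃ * a₄)) - g * x * (2 - x * (a₃ + a₄)) +
      (g * x * (e₁₂ + e₃₄) * ((1 - x * a₃) * (1 - x * a₄))
      + h * (a₃ + a₄ - 2 * x * (a₃ * a₄)) - g * x * (2 - x * (a₃ + a₄))) = 0 := by
    linear_combination (1 - x * a₃) * (1 - x * a₄) * hT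
      - 2 * (h * a₃ * (1 - x * a₄) * h3 + h * a₄ * (1 - x * a₃) * h4)
      + 2 * g * x * ((1 - x * a₄) * h3 + (1 - x * a₃) * h4)
  have hT2 : 4 * x * (g ^ 2 * x ^ 2 * ((1 - a₃ * a₄) * e₁₂) - 2 * g * h - h ^ 2 * (a₃ * a₄)) = 0 := by
    linear_combination h * hT1 - 2 * g * x * (e₁₂ + e₃₄) * hP - 4 * g ^ 2 * x ^ 3 * h7
      - 2 * h * hs - 2 * g * x ^ 2 * hs
  linear_combination (1 - x ^ 2) * x ^ 2 * (h + 2 * g) * hT2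
    - 4 * x * (x ^ 2 * (h + 2 * g)) * (g ^ 2 * x ^ 2 * (1 - a₃ * a₄)) * h2
    + 4 * x * (g ^ 2 * x ^ 2 + h ^ 2 * (1 - x ^ 2)) * hr

end AreaSystem

end AreaSystem

/-! ### Dual numbers, and rhombi -/

section Dual

open TrivSqZeroExt DualNumber

theorem dual_fst_two : (2 : ℝ[ε]).fst = 2 := rfl

theorem dual_snd_two : (2 : ℝ[ε]).snd = 0 := rfl

theorem dual_fst_four : (4 : ℝ[ε]).fst = 4 := rfl

theorem dual_snd_four : (4 : ℝ[ε]).snd = 0 := rfl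

/-- This lifts case distinctions from `ℝ` to `ℝ[ε]`: in a vanishing product, a factor with nonzero
real part can be cancelled, and the other factor vanishes including its `ε`-part. -/
theorem dual_isUnit {x : ℝ[ε]} (hx : x.fst ≠ 0) : IsUnit x :=
  isUnit_iff_isUnit_fst.2 (isUnit_iff_ne_zero.2 hx)

theorem dual_eq_zero_of_mul_left {x y : ℝ[ε]} (hx : x.fst ≠ 0) (h : x * y = 0) : y = 0 :=
  (dual_isUnit hx).mul_right_eq_zero.1 h

theorem dual_eq_zero_of_mul_right {x y : ℝ[ε]} (hy : y.fst ≠ 0) (h : x * y = 0) : x = 0 :=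
  dual_eq_zero_of_mul_left hy (by rw [mul_comm, h])

theorem dual_mul_left_cancel {x y z : ℝ[ε]} (hx : x.fst ≠ 0) (h : x * y = x * z) : y = z :=
  (dual_isUnit hx).mul_left_cancel h

theorem snd_eq_zero_of_sq {x : ℝ[ε]} (hx : x.fst ≠ 0) (h : (x * x).snd = 0) : x.snd = 0 := by
  rw [DualNumber.snd_mul] at h
  have : x.fst * x.snd = 0 := by linarith
  exact (mul_eq_zero.1 this).resolve_left hx

/-- Distinct real parts are simple roots of `T² - (x + y) T + xy`, and simple roots are constant to
first order when the coefficients are. -/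
theorem snd_eq_zero_of_add_of_mul {x y : ℝ[ε]} (hxy : x.fst ≠ y.fst) (hs : (x + y).snd = 0)
    (hp : (x * y).snd = 0) : x.snd = 0 ∧ y.snd = 0 := by
  rw [DualNumber.snd_mul] at hp
  rw [snd_add] at hs
  have hy : y.snd = -x.snd := by linarith
  rw [hy] at hp
  have h0 : (x.fst - y.fst) * x.snd = 0 := by linarith
  have hx := (mul_eq_zero.1 h0).resolve_left (sub_ne_zero.2 hxy)
  exact ⟨hx, by rw [hy, hx, neg_zero]⟩

namespace AreaSystem

variable {m : ℝ} {a₁ a₂ a₃ a₄ e₁₂ e₁₃ e₁₄ e₂₃ e₂₄ e₃₄ t : ℝ[ε]}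

theorem fst {g h : ℝ[ε]} (H : AreaSystem g h a₁ a₂ a₃ a₄ e₁₂ e₁₃ e₁₄ e₂₃ e₂₄ e₃₄ t) :
    AreaSystem g.fst h.fst a₁.fst a₂.fst a₃.fst a₄.fst e₁₂.fst e₁₃.fst e₁₄.fst e₂₃.fst e₂₄.fst
      e₃₄.fst t.fst :=
  H.map (fstHom ℝ ℝ ℝ : ℝ[ε] →+* ℝ)

/-- Rhombi are nondegenerate. -/
theorem snd_eq_zero_of_rhombus (hm0 : 0 < m)
    (H : AreaSystem 1 (inl m) a₁ a₂ a₃ a₄ e₁₂ e₁₃ e₁₄ e₂₃ e₂₄ e₃₄ t)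
    (p₁₂ : 0 < 1 - a₁.fst * a₂.fst) (p₃₄ : 0 < 1 - a₃.fst * a₄.fst)
    (h₁₂ : a₁.fst = a₂.fst) (h₃₄ : a₃.fst = a₄.fst) :
    a₁.snd = 0 ∧ a₂.snd = 0 ∧ a₃.snd = 0 ∧ a₄.snd = 0 := by
  have F := H.fst
  simp only [fst_one, fst_inl, h₁₂, h₃₄] at F p₁₂ p₃₄
  have hx : a₂.fst = -(m * a₄.fst) := by linarith [F.sum_eq]
  set y := a₄.fst with hy
  have hq : 0 < 1 + m * (y * y) := by nlinarith [mul_self_nonneg y]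
  have v₁₂ : e₁₂.fst = (1 - m ^ 2 * (y * y))⁻¹ := by
    refine eq_inv_of_mul_eq_one_left ?_
    have := F.inv₁₂; rw [hx] at this; linear_combination this
  have v₃₄ : e₃₄.fst = (1 - y * y)⁻¹ := eq_inv_of_mul_eq_one_left F.inv₃₄
  have hv : ∀ e : ℝ, e * (1 - a₂.fst * y) = 1 → e = (1 + m * (y * y))⁻¹ := fun e he => by
    refine eq_inv_of_mul_eq_one_left ?_
    rw [hx] at he; linear_combination he
  have v₁₃ := hv _ F.inv₁₃
  have v₁₄ := hv _ F.inv₁₄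
  have v₂₃ := hv _ F.inv₂₃
  have v₂₄ := hv _ F.inv₂₄
  have p₁₂' : 0 < 1 - m ^ 2 * (y * y) := by rw [hx] at p₁₂; linarith
  -- At a rhombus the cofactor of `a₁ - a₂` is `2my² / (1 + my²)² - 1 / (1 - m²y²)`, a number below
  -- 1 minus a number at least 1; that of `a₃ - a₄` is `m` times a similar difference. Hence both
  -- symmetries persist over `ℝ[ε]`.
  have small : 2 * (m * (y * y)) * ((1 + m * (y * y))⁻¹ * (1 + m * (y * y))⁻¹) < 1 := by
    rw [← mul_inv, ← div_eq_mul_inv, div_lt_one (by positivity)]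
    nlinarith [mul_self_nonneg (m * (y * y))]
  have one_lt {d : ℝ} (hd : 0 < d) (hd' : d ≤ 1) : 1 ≤ d⁻¹ := (one_le_inv₀ hd).2 hd'
  have i₁₂ : 1 ≤ (1 - m ^ 2 * (y * y))⁻¹ :=
    one_lt p₁₂' (by nlinarith [mul_self_nonneg (m * y)])
  have i₃₄ : 1 ≤ (1 - y * y)⁻¹ := one_lt p₃₄ (by nlinarith [mul_self_nonneg y])
  have E₁₂ : a₁ = a₂ := by
    refine sub_eq_zero.1 (dual_eq_zero_of_mul_right ?_ H.sub_mul_eq_zero)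
    simp only [fst_sub, fst_mul, fst_add, fst_pow, fst_inl, fst_one, h₃₄, v₁₂, v₁₃, v₁₄, v₂₃, v₂₄,
      ← hy]
    nlinarith
  have E₃₄ : a₃ = a₄ := by
    refine sub_eq_zero.1 (dual_eq_zero_of_mul_right ?_ H.swap.sub_mul_eq_zero)
    simp only [fst_sub, fst_mul, fst_add, fst_pow, fst_inl, fst_one, h₁₂, v₃₄, v₁₃, v₁₄, v₂₃, v₂₄,
      hx]
    nlinarith
  subst E₁₂ E₃₄
  have hs : a₁ = -(inl m * a₃) := by
    have h2 : (2 : ℝ[ε]) * (a₁ + inl m * a₃) = 0 := by linear_combination H.sum_eq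
    exact eq_neg_of_add_eq_zero_left (dual_eq_zero_of_mul_left (by simp [dual_fst_two]) h2)
  have E₂₃ : e₂₃ = e₁₃ := by linear_combination e₁₃ * H.inv₂₃ - e₂₃ * H.inv₁₃
  have E₁₄ : e₁₄ = e₁₃ := by linear_combination e₁₃ * H.inv₁₄ - e₁₄ * H.inv₁₃
  have key : a₃ * (inl m * (e₁₂ + e₃₄ - 4 * e₁₃)) = 0 := by
    have h1 := H.eq₁
    have h3 := H.eq₃
    rw [E₁₄] at h1
    rw [E₂₃] at h3
    rw [hs] at h1 h3
    linear_combination h3 - h1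
  have hfin : a₃.snd = 0 := by
    -- The system also has the solution with all real areas zero; there the cofactor of `a₃` in
    -- `key` has real part `-2m`.
    by_cases hy0 : a₃.fst = 0
    · have : a₃ = 0 := by
        refine dual_eq_zero_of_mul_right ?_ key
        simp only [fst_sub, fst_mul, fst_add, fst_inl, dual_fst_four, v₁₂, v₃₄, v₁₃, hy, hy0]
        simp only [mul_zero, sub_zero, inv_one, add_zero, mul_one]
        exact mul_ne_zero hm0.ne' (by norm_num)
      rw [this, snd_zero]
    · have hE := dual_eq_zero_of_mul_left (x := inl m) (by simpa using hm0.ne')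
        (dual_eq_zero_of_mul_left hy0 key)
      have g := congrArg snd hE
      have g12 := congrArg snd H.inv₁₂
      have g34 := congrArg snd H.inv₃₄
      have g13 := congrArg snd H.inv₁₃
      rw [hs] at g12 g13
      have w₁₂ : 0 < e₁₂.fst := v₁₂ ▸ inv_pos.2 p₁₂'
      have w₃₄ : 0 < e₃₄.fst := v₃₄ ▸ inv_pos.2 p₃₄
      have w₁₃ : 0 < e₁₃.fst := v₁₃ ▸ inv_pos.2 hq
      have f12 := F.inv₁₂
      have f34 := F.inv₃₄
      have f13 := F.inv₁₃
      rw [hx] at f12 f13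
      simp only [snd_sub, snd_add, DualNumber.snd_mul, fst_sub, fst_mul, fst_inl, snd_inl,
        dual_fst_four, dual_snd_four, snd_zero, snd_one, fst_one, fst_neg, snd_neg, ← hy]
        at g g12 g34 g13
      have k12 : e₁₂.snd = 2 * m ^ 2 * y * a₃.snd * e₁₂.fst ^ 2 := by
        linear_combination e₁₂.fst * g12 - e₁₂.snd * f12
      have k34 : e₃₄.snd = 2 * y * a₃.snd * e₃₄.fst ^ 2 := by
        linear_combination e₃₄.fst * g34 - e₃₄.snd * f34
      have k13 : e₁₃.snd = -2 * m * y * a₃.snd * e₁₃.fst ^ 2 := by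
        linear_combination e₁₃.fst * g13 - e₁₃.snd * f13
      -- The function `e₁₂ + e₃₄ - 4 e₁₃` is strictly increasing in `y²`: the three contributions to
      -- its derivative have the same sign.
      have h0 : (2 * m ^ 2 * e₁₂.fst ^ 2 + 2 * e₃₄.fst ^ 2 + 8 * m * e₁₃.fst ^ 2) * (y * a₃.snd)
          = 0 := by
        rw [k12, k34, k13] at g
        linear_combination g
      exact (mul_eq_zero.1 ((mul_eq_zero.1 h0).resolve_left (by positivity))).resolve_left hy0
  have h1 : a₁.snd = 0 := by
    rw [hs]; simp [hfin]
  exact ⟨h1, h1, hfin, hfin⟩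

end AreaSystem

end Dual

/-! ### Kites -/

section Dual

open TrivSqZeroExt DualNumber

/-- A kite whose axis passes through the two vortices of strength `m` does not admit an
infinitesimal symmetry-breaking deformation. -/
theorem kite_transversal {m x y z : ℝ} (hm0 : 0 < m) (hm1 : m < 1) (hX : x ^ 2 < 1)
    (hs : 1 * (x + x) + m * (y + z) = 0) (hr : (m + 2 * 1) * x ^ 2 * (y * z) = -m)
    (hP : m * ((1 - x * y) * (1 - x * z)) = 2 * 1 * x ^ 2 * (1 - y * z))
    (hf : x ^ 2 * (x ^ 2 * (m + 2) + m) = (1 - x ^ 2) * (2 * m * (m + 2) * x ^ 2 - m ^ 3)) :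
    1 * ((1 - x * y) * (1 - x * y) * ((1 - x * z) * (1 - x * z))) ≠
      m * (1 - x * x) * (y ^ 2 * ((1 - x * z) * (1 - x * z)) +
        z ^ 2 * ((1 - x * y) * (1 - x * y))) := by
  intro hd
  have hx0 : x ≠ 0 := by
    rintro rfl
    simp at hr
    exact hm0.ne' hr
  -- In terms of `C` both the vanishing of the symmetry-breaking cofactor (`h5`) and the kite
  -- equation (`hf'`) are polynomial equations in one unknown.
  obtain ⟨C, hC⟩ : ∃ C, C = (m + 2) * x ^ 2 := ⟨_, rfl⟩
  have hC0 : 0 < C := by rw [hC]; positivity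
  have hCQ : 0 < m + 2 - C := by rw [hC]; nlinarith
  have hrC : C * (y * z) = -m := by rw [hC]; linear_combination hr
  have e1 : m * (m + 2) * ((1 - x * y) * (1 - x * z)) = 2 * (C + m) := by
    linear_combination (m + 2) * hP - 2 * (1 - y * z) * hC - 2 * hrC
  have e2 : m * (y + z - 2 * x * (y * z)) = -2 * x * (1 + m * (y * z)) := by
    linear_combination hs
  have e3 : C * (m * (y + z - 2 * x * (y * z))) = -2 * x * (C - m ^ 2) := by
    rw [e2]; linear_combination -2 * x * m * hrC
  have hd' : ((1 - x * y) * (1 - x * z)) ^ 2 = m * (1 - x ^ 2) *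
      ((y + z - 2 * x * (y * z)) ^ 2 - 2 * (y * z) * ((1 - x * y) * (1 - x * z))) := by
    linear_combination hd
  generalize (1 - x * y) * (1 - x * z) = P at *
  generalize y + z - 2 * x * (y * z) = N at *
  have h4 : 4 * C * (C * (C + m) ^ 2) =
      4 * C * (m * (m + 2 - C) * ((C - m ^ 2) ^ 2 + m ^ 2 * (C + m))) := by
    have hl : (C * (m * (m + 2) * P)) ^ 2 = m * (m + 2) ^ 2 * (1 - x ^ 2) *
        ((C * (m * N)) ^ 2 - 2 * (C * (y * z)) * (C * (m * (m * P)))) := by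
      linear_combination (C * m * (m + 2)) ^ 2 * hd'
    rw [e1, e3, hrC] at hl
    have hx2 : (m + 2) * (1 - x ^ 2) = m + 2 - C := by rw [hC]; ring
    rw [← hx2]
    linear_combination hl + 2 * m ^ 3 * (m + 2) * (1 - x ^ 2) * C * e1
      - 4 * m * (m + 2) * (1 - x ^ 2) * (C - m ^ 2) ^ 2 * hC
  have h5 := mul_left_cancel₀ (by positivity) h4
  have hf' : C * (C + m) = (m + 2 - C) * (m * (2 * C - m ^ 2)) := by
    rw [hC]; linear_combination (m + 2) * hf
  have h6 : m * (m + 2 - C) * ((2 * C - m ^ 2) * (C + m)) =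
      m * (m + 2 - C) * ((C - m ^ 2) ^ 2 + m ^ 2 * (C + m)) := by
    linear_combination h5 - (C + m) * hf'
  have h7 := mul_left_cancel₀ (mul_pos hm0 hCQ).ne' h6
  -- The constant terms of the quadratics `h7` and `hf'` cancel in their sum, which gives `C = m (m
  -- + 1) / 2`. Inserted into `h7`, this is possible only for `m = 1` among positive `m`.
  have h8 : (2 * (m + 1) * C) * C = (2 * (m + 1) * C) * (m * (m + 1) / 2) := by
    linear_combination h7 + hf'
  have h9 := mul_left_cancel₀ (by positivity) h8
  rw [h9] at h7
  have h10 : m ^ 2 * ((1 - m) * (3 * m + 5)) = 0 := by linear_combination 4 * h7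
  have h11 : 0 < m ^ 2 * ((1 - m) * (3 * m + 5)) := by
    have : 0 < 1 - m := by linarith
    positivity
  exact h11.ne' h10

/-- There is no kite whose axis passes through the two vortices of strength `1 > m`. -/
theorem kite_quadratic_pos {m X : ℝ} (hm0 : 0 < m) (hm1 : m < 1) (hX0 : 0 < X) (hX1 : X < 1) :
    0 < m ^ 2 * X * (X * (1 + 2 * m) + 1) - (1 - X) * (2 * m * (1 + 2 * m) * X - 1) := by
  have e : m ^ 2 * X * (X * (1 + 2 * m) + 1) - (1 - X) * (2 * m * (1 + 2 * m) * X - 1) =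
    (1 - X) ^ 2 + (1 - 3 * m) * (1 + m) * (X * (1 - X)) + 2 * m ^ 2 * (1 + m) * X ^ 2 := by ring
  rw [e]
  have hY : 0 < 1 - X := by linarith
  rcases le_total m (1 / 3) with h | h
  · have : 0 ≤ 1 - 3 * m := by linarith
    positivity
  -- The expression `e` is a quadratic form in `1 - X` and `X`. Its discriminant is `-(1 + m) (1 -
  -- m) (9m² + 4m - 1)`, negative here, and `h3` completes the square.
  · have h1 : 0 < (1 - m) * (9 * m ^ 2 + 4 * m - 1) := mul_pos (by linarith) (by nlinarith)
    have h2 : 0 < (1 + m) * ((1 - m) * (9 * m ^ 2 + 4 * m - 1)) * X ^ 2 := by positivity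
    have h3 := sq_nonneg (2 * (1 - X) + (1 - 3 * m) * (1 + m) * X)
    nlinarith

namespace AreaSystem

section Asymmetric

variable {S : Type*} [CommRing S] {m a₁ a₂ a₃ a₄ : S}

/-- The polynomial `(1 - a₁ T)(1 - a₂ T) = 1 + m (a₃ + a₄) T - m T²` has the same value `1 + m a₃
a₄` at `T = a₃` and at `T = a₄`. -/
theorem prod_of_mul_eq_neg (hs : 1 * (a₁ + a₂) + m * (a₃ + a₄) = 0) (hq : m + a₁ * a₂ = 0) :
    (1 - a₁ * a₃) * (1 - a₂ * a₃) = 1 + m * (a₃ * a₄) ∧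
    (1 - a₁ * a₄) * (1 - a₂ * a₄) = 1 + m * (a₃ * a₄) ∧
    a₁ ^ 2 * ((1 - a₂ * a₃) * (1 - a₂ * a₄)) + a₂ ^ 2 * ((1 - a₁ * a₃) * (1 - a₁ * a₄)) =
      2 * m * (1 + m * (a₃ * a₄)) := by
  refine ⟨by linear_combination -a₃ * hs + a₃ ^ 2 * hq, by linear_combination -a₄ * hs + a₄ ^ 2 * hq,
    ?_⟩
  linear_combination (a₁ + a₂) * hs
    + (-2 - (a₃ + a₄) * (a₁ + a₂) + 2 * (a₃ * a₄) * (a₁ * a₂ - m)) * hq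

/-- The same observation with the pairs exchanged: `m (1 - a₃ T)(1 - a₄ T) = m + (a₁ + a₂) T - T²`
has the value `m + a₁ a₂` at both `a₁` and `a₂`. -/
theorem prod_of_mul_eq_neg_inv (hs : 1 * (a₁ + a₂) + m * (a₃ + a₄) = 0)
    (hq : 1 + m * (a₃ * a₄) = 0) :
    m * ((1 - a₁ * a₃) * (1 - a₁ * a₄)) = m + a₁ * a₂ ∧
    m * ((1 - a₂ * a₃) * (1 - a₂ * a₄)) = m + a₁ * a₂ ∧
    m ^ 2 * (a₃ ^ 2 * ((1 - a₁ * a₄) * (1 - a₂ * a₄)) +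
      a₄ ^ 2 * ((1 - a₁ * a₃) * (1 - a₂ * a₃))) = 2 * (m + a₁ * a₂) := by
  refine ⟨by linear_combination -a₁ * hs + a₁ ^ 2 * hq, by linear_combination -a₂ * hs + a₂ ^ 2 * hq,
    ?_⟩
  linear_combination m * (a₃ + a₄) * hs
    + (-2 * m - m * (a₃ + a₄) * (a₁ + a₂) + 2 * (a₁ * a₂) * (m * (a₃ * a₄) - 1)) * hq

end Asymmetric

variable {m : ℝ} {a₁ a₂ a₃ a₄ e₁₂ e₁₃ e₁₄ e₂₃ e₂₄ e₃₄ t : ℝ[ε]}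

/-- Kites whose axis passes through the vortices of strength `m` are nondegenerate. -/
theorem snd_eq_zero_of_kite (hm0 : 0 < m) (hm1 : m < 1)
    (H : AreaSystem 1 (inl m) a₁ a₂ a₃ a₄ e₁₂ e₁₃ e₁₄ e₂₃ e₂₄ e₃₄ t)
    (p₁₂ : 0 < 1 - a₁.fst * a₂.fst) (h₁₂ : a₁.fst = a₂.fst) (h₃₄ : a₃.fst ≠ a₄.fst) :
    a₁.snd = 0 ∧ a₂.snd = 0 ∧ a₃.snd = 0 ∧ a₄.snd = 0 := by
  have hK : 1 * (a₁ ^ 2 * (e₁₃ * e₁₄) + a₂ ^ 2 * (e₂₃ * e₂₄)) - inl m * e₃₄ = 0 :=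
    dual_eq_zero_of_mul_left (by simpa [sub_eq_zero] using h₃₄) H.swap.sub_mul_eq_zero
  have F := H.fst
  have FK := congrArg TrivSqZeroExt.fst hK
  simp only [fst_sub, fst_mul, fst_add, fst_pow, fst_zero, fst_one, fst_inl, h₁₂] at F FK p₁₂
  rw [sub_eq_zero] at FK
  obtain ⟨FP, Fr⟩ := F.kite_prod FK
  have hx0 : a₂.fst ≠ 0 := by
    intro h0
    rw [h0] at Fr
    simp at Fr
    exact hm0.ne' Fr
  have Fq := (mul_eq_zero.1 (F.kite_quadratic FK)).resolve_left (by simpa using hx0)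
  -- By `kite_transversal` the cofactor of `a₁ - a₂` is a unit, so a first-order deformation of a
  -- kite remains a kite.
  have E₁₂ : a₁ = a₂ := by
    refine sub_eq_zero.1 (dual_eq_zero_of_mul_right ?_ H.sub_mul_eq_zero)
    simp only [fst_sub, fst_mul, fst_add, fst_pow, fst_inl, fst_one]
    rw [sub_ne_zero]
    intro h0
    refine kite_transversal hm0 hm1 (by linarith [sq a₂.fst]) F.sum_eq Fr FP ?_ (F.prod_eq h0)
    linear_combination Fq
  subst E₁₂
  rw [sub_eq_zero] at hK
  obtain ⟨-, Hr⟩ := H.kite_prod hK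
  have Hq := dual_eq_zero_of_mul_left (by
    simp only [fst_mul, dual_fst_four]; simpa using hx0) (H.kite_quadratic hK)
  obtain ⟨X, hX⟩ : ∃ X, X = a₁ * a₁ := ⟨_, rfl⟩
  have hX0 : X.fst = a₁.fst ^ 2 := by rw [hX, fst_mul, sq]
  have Hq' : (inl m + 2) * (2 * inl m + 1) * (X * X)
      - inl m * (inl m * inl m + 2 * inl m + 3) * X + inl m * inl m * inl m = 0 := by
    rw [hX]; linear_combination Hq
  have f3 : (3 : ℝ[ε]).fst = 3 := rfl
  have s3 : (3 : ℝ[ε]).snd = 0 := rfl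
  have hXs : X.snd = 0 := by
    have q0 := congrArg TrivSqZeroExt.fst Hq'
    have q1 := congrArg TrivSqZeroExt.snd Hq'
    simp only [snd_sub, snd_add, DualNumber.snd_mul, fst_sub, fst_add, fst_mul, fst_inl, snd_inl,
      fst_one, snd_one, fst_zero, snd_zero, dual_fst_two, dual_snd_two, f3, s3] at q0 q1
    have q2 : (2 * (m + 2) * (2 * m + 1) * X.fst - m * (m * m + 2 * m + 3)) * X.snd = 0 := by
      linear_combination q1
    refine (mul_eq_zero.1 q2).resolve_left fun h0 => ?_
    -- A root of `Hq'` that moves to first order would be a double root; the left side is the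
    -- discriminant of the quadratic in `X`, positive for `0 < m < 1`.
    have hdisc : m ^ 2 * ((1 - m) * (1 + m) * (9 + 4 * m - m ^ 2)) = 0 := by
      linear_combination (2 * (m + 2) * (2 * m + 1) * X.fst - m * (m * m + 2 * m + 3)) * h0
        - 4 * (m + 2) * (2 * m + 1) * q0
    have h1 : 0 < 1 - m := by linarith
    have h2 : 0 < 9 + 4 * m - m ^ 2 := by nlinarith
    have : 0 < m ^ 2 * ((1 - m) * (1 + m) * (9 + 4 * m - m ^ 2)) := by positivity
    exact this.ne' hdisc
  have h1 : a₁.snd = 0 := snd_eq_zero_of_sq hx0 (hX ▸ hXs)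
  have hsum : (a₃ + a₄).snd = 0 := by
    have := congrArg TrivSqZeroExt.snd H.sum_eq
    simp only [snd_add, DualNumber.snd_mul, fst_inl, snd_inl, fst_one, snd_one, snd_zero,
      h1, fst_add] at this
    rw [snd_add]
    have h0 : m * (a₃.snd + a₄.snd) = 0 := by linear_combination this
    exact (mul_eq_zero.1 h0).resolve_left hm0.ne'
  have hprod : (a₃ * a₄).snd = 0 := by
    have hr' : (inl m + 2 * 1) * X * (a₃ * a₄) = -inl m := by rw [hX]; linear_combination Hr
    have := congrArg TrivSqZeroExt.snd hr'
    simp only [snd_add, fst_add, fst_inl, snd_inl, fst_one, snd_one, snd_neg, fst_mul,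
      DualNumber.snd_mul, dual_fst_two, dual_snd_two, hXs] at this
    have h0 : (m + 2) * X.fst * (a₃ * a₄).snd = 0 := by
      rw [DualNumber.snd_mul]; linear_combination this
    refine (mul_eq_zero.1 h0).resolve_left ?_
    rw [hX0]
    positivity
  obtain ⟨h3, h4⟩ := snd_eq_zero_of_add_of_mul h₃₄ hsum hprod
  exact ⟨h1, h1, h3, h4⟩

/-- There are no kites whose axis passes through the vortices of strength `1`. -/
theorem not_kite {m a₁ a₂ a₃ a₄ e₁₂ e₁₃ e₁₄ e₂₃ e₂₄ e₃₄ t : ℝ} (hm0 : 0 < m) (hm1 : m < 1)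
    (H : AreaSystem 1 m a₁ a₂ a₃ a₄ e₁₂ e₁₃ e₁₄ e₂₃ e₂₄ e₃₄ t)
    (p₃₄ : 0 < 1 - a₃ * a₄) (h₁₂ : a₁ ≠ a₂) : a₃ ≠ a₄ := by
  rintro rfl
  have hK := (mul_eq_zero.1 H.sub_mul_eq_zero).resolve_left (sub_ne_zero.2 h₁₂)
  rw [sub_eq_zero] at hK
  have h := H.swap.kite_quadratic hK
  have hx0 : a₃ ≠ 0 := by
    rintro rfl
    have := (H.swap.kite_prod hK).2
    simp at this
  have h2 := (mul_eq_zero.1 h).resolve_left (by simpa using hx0)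
  have h3 := kite_quadratic_pos (X := a₃ ^ 2) hm0 hm1 (by positivity) (by linarith [sq a₃])
  refine h3.ne' ?_
  linear_combination h2

end AreaSystem

end Dual

/-! ### Trapezoids and asymmetric configurations; rigidity of the area equations -/

section Dual

open TrivSqZeroExt DualNumber

namespace AreaSystem

variable {m : ℝ} {a₁ a₂ a₃ a₄ e₁₂ e₁₃ e₁₄ e₂₃ e₂₄ e₃₄ t : ℝ[ε]}

/-- Isosceles trapezoids are nondegenerate. -/
theorem snd_eq_zero_of_trapezoid (hm0 : 0 < m) {x y : ℝ[ε]} (hx : x.fst ≠ 0) (hy : y.fst ≠ 0)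
    (h1 : 1 - x * x * (y * y) = 2 * inl m * (y * y) * (1 + x * x))
    (h2 : inl m * (1 - x * x * (y * y)) = 2 * (x * x) * (1 + y * y)) :
    x.snd = 0 ∧ y.snd = 0 := by
  have hX : 0 < (x * x).fst := by rw [fst_mul]; exact mul_self_pos.2 hx
  have hY : 0 < (y * y).fst := by rw [fst_mul]; exact mul_self_pos.2 hy
  suffices h : (x * x).snd = 0 ∧ (y * y).snd = 0 from
    ⟨snd_eq_zero_of_sq hx h.1, snd_eq_zero_of_sq hy h.2⟩
  generalize x * x = X at *
  generalize y * y = Y at *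
  have q1 := congrArg TrivSqZeroExt.snd h1
  have q2 := congrArg TrivSqZeroExt.snd h2
  simp only [snd_sub, snd_add, DualNumber.snd_mul, fst_sub, fst_add, fst_mul, fst_inl, snd_inl,
      fst_one, snd_one, dual_fst_two, dual_snd_two] at q1 q2
  -- Up to sign, the Jacobian determinant of the two equations with respect to `(X, Y)`; `k1` and
  -- `k2` are Cramer's rule.
  set D := (X.fst * (1 + 2 * m) + 2 * m) * (Y.fst * (m + 2) + 2)
    - X.fst * Y.fst * (1 + 2 * m) * (m + 2) with hD
  have hDpos : 0 < D := by
    have : D = 2 * X.fst * (1 + 2 * m) + 2 * m * (Y.fst * (m + 2) + 2) := by rw [hD]; ring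
    rw [this]; positivity
  have k1 : D * X.snd = 0 := by
    rw [hD]
    linear_combination (X.fst * (m + 2)) * q1 - (X.fst * (1 + 2 * m) + 2 * m) * q2
  have k2 : D * Y.snd = 0 := by
    rw [hD]
    linear_combination (Y.fst * (1 + 2 * m)) * q2 - (Y.fst * (m + 2) + 2) * q1
  exact ⟨(mul_eq_zero.1 k1).resolve_left hDpos.ne', (mul_eq_zero.1 k2).resolve_left hDpos.ne'⟩

/-- Configurations with neither pair of areas equal are nondegenerate. -/
theorem snd_eq_zero_of_ne_of_ne (hm0 : 0 < m) (hm1 : m < 1)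
    (H : AreaSystem 1 (inl m) a₁ a₂ a₃ a₄ e₁₂ e₁₃ e₁₄ e₂₃ e₂₄ e₃₄ t)
    (p₁₃ : 0 < 1 - a₁.fst * a₃.fst) (p₁₄ : 0 < 1 - a₁.fst * a₄.fst)
    (p₂₃ : 0 < 1 - a₂.fst * a₃.fst)
    (h₁₂ : a₁.fst ≠ a₂.fst) (h₃₄ : a₃.fst ≠ a₄.fst) :
    a₁.snd = 0 ∧ a₂.snd = 0 ∧ a₃.snd = 0 ∧ a₄.snd = 0 := by
  have hm : (inl m : ℝ[ε]).fst ≠ 0 := by simpa using hm0.ne'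
  have hK' := sub_eq_zero.1 (dual_eq_zero_of_mul_left (by simpa [sub_eq_zero] using h₃₄)
    H.swap.sub_mul_eq_zero)
  have hK := sub_eq_zero.1 (dual_eq_zero_of_mul_left (by simpa [sub_eq_zero] using h₁₂)
    H.sub_mul_eq_zero)
  have E1 := H.prod_eq hK
  have E2 := H.swap.prod_eq hK'
  have E3 := dual_eq_zero_of_mul_left (by rw [dual_fst_four]; norm_num)
    (H.trapezoid_factor hK hK')
  rw [mul_comm a₃ a₁, mul_comm a₃ a₂, mul_comm a₄ a₁, mul_comm a₄ a₂] at E2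
  have hs := H.sum_eq
  have F1 := congrArg TrivSqZeroExt.fst E1
  have F2 := congrArg TrivSqZeroExt.fst E2
  have Fs := congrArg TrivSqZeroExt.fst hs
  simp only [fst_sub, fst_mul, fst_add, fst_pow, fst_zero, fst_one, fst_inl] at F1 F2 Fs
  by_cases hp : a₃.fst + a₄.fst = 0
  · have ha4 : a₄.fst = -a₃.fst := by linarith
    have ha2 : a₂.fst = -a₁.fst := by rw [hp] at Fs; linarith
    rw [ha4] at h₃₄ F1 F2 p₁₄
    rw [ha2] at h₁₂ F1 F2 p₂₃
    have ha1 : a₁.fst ≠ 0 := fun h => h₁₂ (by rw [h]; ring)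
    have ha3 : a₃.fst ≠ 0 := fun h => h₃₄ (by rw [h]; ring)
    have hd : 0 < 1 - a₁.fst ^ 2 * a₃.fst ^ 2 := by nlinarith [mul_pos p₁₃ p₂₃]
    have R1 : 1 - a₁.fst ^ 2 * a₃.fst ^ 2 = 2 * m * a₃.fst ^ 2 * (1 + a₁.fst ^ 2) := by
      refine mul_left_cancel₀ hd.ne' ?_
      linear_combination F1
    have R2 : m * (1 - a₁.fst ^ 2 * a₃.fst ^ 2) = 2 * a₁.fst ^ 2 * (1 + a₃.fst ^ 2) := by
      refine mul_left_cancel₀ hd.ne' ?_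
      linear_combination F2
    -- The trapezoid class does not meet the other two: `m a₃² = 1` contradicts `R1`, and `a₁² = m`
    -- contradicts `R2`. So `a₃ + a₄ = 0` also holds over `ℝ[ε]`.
    have hp0 : a₃ + a₄ = 0 := by
      refine dual_eq_zero_of_mul_right ?_ E3
      simp only [fst_mul, fst_add, fst_inl, fst_one]
      rw [ha4, ha2]
      have hX : 0 < a₁.fst ^ 2 := by positivity
      have hY : 0 < a₃.fst ^ 2 := by positivity
      refine mul_ne_zero (fun h => ?_) fun h => ?_
      · have h' : m * a₃.fst ^ 2 = 1 := by linear_combination -h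
        nlinarith [mul_pos hX hY]
      · have h' : a₁.fst ^ 2 = m := by linear_combination -h
        rw [h'] at R2
        nlinarith [mul_pos hm0 hY, mul_pos hm0 (mul_pos hm0 hY)]
    have A4 : a₄ = -a₃ := eq_neg_of_add_eq_zero_right hp0
    have A2 : a₂ = -a₁ := by linear_combination hs - inl m * hp0
    rw [A4, A2] at E1 E2
    have hd' : (1 - a₁ * a₁ * (a₃ * a₃)).fst ≠ 0 := by
      simp only [fst_sub, fst_mul, fst_one]
      intro h
      refine hd.ne' ?_
      linear_combination h
    have S := snd_eq_zero_of_trapezoid hm0 ha1 ha3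
      (dual_mul_left_cancel hd' (by linear_combination E1))
      (dual_mul_left_cancel hd' (by linear_combination E2))
    rw [A4, A2]
    simp [S.1, S.2]
  · have E4 := dual_eq_zero_of_mul_left (by rwa [fst_add]) E3
    have F4 := congrArg TrivSqZeroExt.fst E4
    simp only [fst_mul, fst_add, fst_inl, fst_one, fst_zero] at F4
    rcases mul_eq_zero.1 F4 with h0 | h0
    -- If `a₃ a₄ = -1/m`, the two factor equations determine `a₁ a₂` and `a₁² + a₂²`, and `(a₁ -
    -- a₂)²` comes out negative because `m < 1`.
    · exfalso
      obtain ⟨i1, i2, i3⟩ := prod_of_mul_eq_neg_inv Fs h0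
      have hpos : 0 < m + a₁.fst * a₂.fst := by rw [← i1]; positivity
      have j1 : m + a₁.fst * a₂.fst = 2 * m * (1 - a₁.fst * a₂.fst) := by
        refine mul_left_cancel₀ hpos.ne' ?_
        have : (m * ((1 - a₁.fst * a₃.fst) * (1 - a₁.fst * a₄.fst))) *
            (m * ((1 - a₂.fst * a₃.fst) * (1 - a₂.fst * a₄.fst))) =
            m * (1 - a₁.fst * a₂.fst) * (m ^ 2 * (a₃.fst ^ 2 * ((1 - a₁.fst * a₄.fst) *
              (1 - a₂.fst * a₄.fst)) + a₄.fst ^ 2 * ((1 - a₁.fst * a₃.fst) *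
              (1 - a₂.fst * a₃.fst)))) := by
          linear_combination m ^ 2 * F1
        rw [i1, i2, i3] at this
        linear_combination this
      have j2 : m * (m + a₁.fst * a₂.fst) = (m + 1) * (a₁.fst ^ 2 + a₂.fst ^ 2) := by
        refine mul_left_cancel₀ hpos.ne' ?_
        have : m * ((m * ((1 - a₁.fst * a₃.fst) * (1 - a₁.fst * a₄.fst))) *
            (m * ((1 - a₂.fst * a₃.fst) * (1 - a₂.fst * a₄.fst)))) =
            m * (1 - a₃.fst * a₄.fst) * (a₁.fst ^ 2 * (m * ((1 - a₂.fst * a₃.fst) *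
              (1 - a₂.fst * a₄.fst))) + a₂.fst ^ 2 * (m * ((1 - a₁.fst * a₃.fst) *
              (1 - a₁.fst * a₄.fst)))) := by
          linear_combination m ^ 2 * F2
        rw [i1, i2] at this
        linear_combination this - (m + a₁.fst * a₂.fst) * (a₁.fst ^ 2 + a₂.fst ^ 2) * h0
      have j3 : a₁.fst * a₂.fst * (1 + 2 * m) = m := by linear_combination j1
      have j4 : (m + 1) * (1 + 2 * m) * (a₁.fst - a₂.fst) ^ 2 = -2 * m * (1 - m) * (1 + m) := by
        linear_combination -(1 + 2 * m) * j2 + (m - 2 * (m + 1)) * j3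
      have j5 : 0 ≤ (m + 1) * (1 + 2 * m) * (a₁.fst - a₂.fst) ^ 2 := by positivity
      have j6 : 0 < m * (1 - m) * (1 + m) :=
        mul_pos (mul_pos hm0 (by linarith)) (by linarith)
      nlinarith
    -- If `a₁ a₂ = -m`, the factor equations fix `a₃ a₄` (`n2`) and `(a₃ + a₄)²` (`n1`) as functions
    -- of `m`. Both pairs then have constant sum and product, and distinct members.
    · obtain ⟨i1, i2, -⟩ := prod_of_mul_eq_neg Fs h0
      have hpos : 0 < 1 + m * (a₃.fst * a₄.fst) := by rw [← i1]; positivity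
      have hu : (1 + inl m * (a₃ * a₄)).fst ≠ 0 := by
        simpa only [fst_mul, fst_add, fst_inl, fst_one] using hpos.ne'
      have Hq := dual_eq_zero_of_mul_left hu E4
      obtain ⟨k1, k2, k3⟩ := prod_of_mul_eq_neg hs Hq
      have n2 : 1 + inl m * (a₃ * a₄) = 2 * (1 - a₃ * a₄) := by
        refine dual_mul_left_cancel hu (dual_mul_left_cancel hm ?_)
        have : inl m * (((1 - a₁ * a₃) * (1 - a₂ * a₃)) * ((1 - a₁ * a₄) * (1 - a₂ * a₄))) =
            (1 - a₃ * a₄) * (a₁ ^ 2 * ((1 - a₂ * a₃) * (1 - a₂ * a₄))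
              + a₂ ^ 2 * ((1 - a₁ * a₃) * (1 - a₁ * a₄))) := by
          linear_combination E2
        rw [k1, k2, k3] at this
        linear_combination this
      have n1 : 1 + inl m * (a₃ * a₄) =
          inl m * (1 + inl m) * ((a₃ + a₄) * (a₃ + a₄) - 2 * (a₃ * a₄)) := by
        refine dual_mul_left_cancel hu ?_
        have := E1
        rw [k1, k2] at this
        linear_combination this - inl m * (1 + inl m * (a₃ * a₄)) * (a₃ ^ 2 + a₄ ^ 2) * Hq
      have q' : (a₃ * a₄).snd = 0 := by
        have := congrArg TrivSqZeroExt.snd n2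
        generalize a₃ * a₄ = q at this
        simp only [snd_sub, snd_add, DualNumber.snd_mul, fst_sub, fst_inl, snd_inl,
          snd_one, dual_fst_two, dual_snd_two] at this
        have h1 : (m + 2) * q.snd = 0 := by linear_combination this
        exact (mul_eq_zero.1 h1).resolve_left (by positivity)
      have s' : (a₃ + a₄).snd = 0 := by
        refine snd_eq_zero_of_sq (by rwa [fst_add]) ?_
        have := congrArg TrivSqZeroExt.snd n1
        generalize a₃ * a₄ = q at this q'
        generalize (a₃ + a₄) * (a₃ + a₄) = p at this
        simp only [snd_sub, snd_add, DualNumber.snd_mul, fst_sub, fst_add, fst_mul, fst_inl,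
          snd_inl, fst_one, snd_one, dual_fst_two, dual_snd_two, q'] at this
        have h1 : m * (1 + m) * p.snd = 0 := by linear_combination -this
        exact (mul_eq_zero.1 h1).resolve_left (by positivity)
      have s : (a₁ + a₂).snd = 0 := by
        have h1 : a₁ + a₂ = -(inl m * (a₃ + a₄)) := by linear_combination hs
        rw [h1, snd_neg, DualNumber.snd_mul, s', snd_inl]
        ring
      have q : (a₁ * a₂).snd = 0 := by
        have h1 : a₁ * a₂ = -inl m := by linear_combination Hq
        rw [h1, snd_neg, snd_inl, neg_zero]
      obtain ⟨r1, r2⟩ := snd_eq_zero_of_add_of_mul h₁₂ s q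
      obtain ⟨r3, r4⟩ := snd_eq_zero_of_add_of_mul h₃₄ s' q'
      exact ⟨r1, r2, r3, r4⟩

/-- For `0 < m < 1` the solutions of the area equations are infinitesimally rigid. -/
theorem snd_eq_zero (hm0 : 0 < m) (hm1 : m < 1)
    (H : AreaSystem 1 (inl m) a₁ a₂ a₃ a₄ e₁₂ e₁₃ e₁₄ e₂₃ e₂₄ e₃₄ t)
    (p₁₂ : 0 < 1 - a₁.fst * a₂.fst)
    (p₁₃ : 0 < 1 - a₁.fst * a₃.fst) (p₁₄ : 0 < 1 - a₁.fst * a₄.fst)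
    (p₂₃ : 0 < 1 - a₂.fst * a₃.fst) (p₃₄ : 0 < 1 - a₃.fst * a₄.fst) :
    a₁.snd = 0 ∧ a₂.snd = 0 ∧ a₃.snd = 0 ∧ a₄.snd = 0 := by
  by_cases h₁₂ : a₁.fst = a₂.fst
  · by_cases h₃₄ : a₃.fst = a₄.fst
    · exact H.snd_eq_zero_of_rhombus hm0 p₁₂ p₃₄ h₁₂ h₃₄
    · exact H.snd_eq_zero_of_kite hm0 hm1 p₁₂ h₁₂ h₃₄
  · exact H.snd_eq_zero_of_ne_of_ne hm0 hm1 p₁₃ p₁₄ p₂₃ h₁₂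
      (not_kite hm0 hm1 (by simpa using H.fst) p₃₄ h₁₂)

end AreaSystem

end Dual

/-! ### Signed areas and the Dziobek relations -/

section SignedAreas

variable {S : Type*} [CommRing S]

/-- The (doubled) signed areas of the four triangles spanned by four points of the plane, with the
signs for which they are the coefficients of an affine relation. -/
def signedArea (X Y : Fin 4 → S) : Fin 4 → S :=
  ![X 1 * (Y 2 - Y 3) + X 2 * (Y 3 - Y 1) + X 3 * (Y 1 - Y 2),
    -(X 0 * (Y 2 - Y 3) + X 2 * (Y 3 - Y 0) + X 3 * (Y 0 - Y 2)),
    X 0 * (Y 1 - Y 3) + X 1 * (Y 3 - Y 0) + X 3 * (Y 0 - Y 1),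
    -(X 0 * (Y 1 - Y 2) + X 1 * (Y 2 - Y 0) + X 2 * (Y 0 - Y 1))]

/-- The squared distance of two points of the plane. -/
def sqDist (X Y : Fin 4 → S) (i j : Fin 4) : S := (X i - X j) ^ 2 + (Y i - Y j) ^ 2

theorem sum_signedArea (X Y : Fin 4 → S) : signedArea X Y 0 + signedArea X Y 1 + signedArea X Y 2
    + signedArea X Y 3 = 0 := by
  simp [signedArea]; ring

theorem sum_signedArea_mul_fst (X Y : Fin 4 → S) : signedArea X Y 0 * X 0 + signedArea X Y 1 * X 1
    + signedArea X Y 2 * X 2 + signedArea X Y 3 * X 3 = 0 := by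
  simp [signedArea]; ring

theorem sum_signedArea_mul_snd (X Y : Fin 4 → S) : signedArea X Y 0 * Y 0 + signedArea X Y 1 * Y 1
    + signedArea X Y 2 * Y 2 + signedArea X Y 3 * Y 3 = 0 := by
  simp [signedArea]; ring

/-- Cramer's rule: the signed areas are the maximal minors of the system of affine relations, so
every affine relation is proportional to them. Stated by cross-multiplication, this needs no
division. -/
theorem mul_signedArea_comm {X Y : Fin 4 → S} {n : Fin 4 → S} (h1 : ∑ j, n j = 0)
    (hX : ∑ j, n j * X j = 0) (hY : ∑ j, n j * Y j = 0) (i j : Fin 4) :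
    n i * signedArea X Y j = n j * signedArea X Y i := by
  rw [Fin.sum_univ_four] at h1 hX hY
  have h01 : n 0 * signedArea X Y 1 = n 1 * signedArea X Y 0 := by
    simp [signedArea]
    linear_combination -((X 2 * Y 3 - X 3 * Y 2) * h1 + (Y 2 - Y 3) * hX + (X 3 - X 2) * hY)
  have h02 : n 0 * signedArea X Y 2 = n 2 * signedArea X Y 0 := by
    simp [signedArea]
    linear_combination (X 1 * Y 3 - X 3 * Y 1) * h1 + (Y 1 - Y 3) * hX + (X 3 - X 1) * hY
  have h03 : n 0 * signedArea X Y 3 = n 3 * signedArea X Y 0 := by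
    simp [signedArea]
    linear_combination -((X 1 * Y 2 - X 2 * Y 1) * h1 + (Y 1 - Y 2) * hX + (X 2 - X 1) * hY)
  have h12 : n 1 * signedArea X Y 2 = n 2 * signedArea X Y 1 := by
    simp [signedArea]
    linear_combination -((X 0 * Y 3 - X 3 * Y 0) * h1 + (Y 0 - Y 3) * hX + (X 3 - X 0) * hY)
  have h13 : n 1 * signedArea X Y 3 = n 3 * signedArea X Y 1 := by
    simp [signedArea]
    linear_combination (X 0 * Y 2 - X 2 * Y 0) * h1 + (Y 0 - Y 2) * hX + (X 2 - X 0) * hY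
  have h23 : n 2 * signedArea X Y 3 = n 3 * signedArea X Y 2 := by
    simp [signedArea]
    linear_combination -((X 0 * Y 1 - X 1 * Y 0) * h1 + (Y 0 - Y 1) * hX + (X 1 - X 0) * hY)
  fin_cases i <;> fin_cases j <;> first | rfl | assumption | (symm; assumption)

/-- The coefficients of a planar equilibrium form a matrix which is of rank one off the
diagonal. -/
theorem exists_eq_mul_signedArea {X Y : Fin 4 → S} {C : Fin 4 → Fin 4 → S}
    (hC : ∀ i j, C i j = C j i) (hX : ∀ i, ∑ j, C i j * (X i - X j) = 0)
    (hY : ∀ i, ∑ j, C i j * (Y i - Y j) = 0) {k : Fin 4} (hk : IsUnit (signedArea X Y k)) :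
    ∃ κ : S, ∀ i j, i ≠ j → C i j = κ * (signedArea X Y i * signedArea X Y j) := by
  -- The diagonal is changed so that every row sums to zero. The equilibrium equations then say that
  -- each row of `N` is an affine relation between the four points.
  obtain ⟨N, hN⟩ : ∃ N : Fin 4 → Fin 4 → S,
      N = fun i j => C i j - if i = j then ∑ l, C i l else 0 := ⟨_, rfl⟩
  have hsymm : ∀ i j, N i j = N j i := fun i j => by
    by_cases h : i = j
    · rw [h]
    · simp [hN, h, Ne.symm h, hC i j]
  have hrow (Z : Fin 4 → S) (i : Fin 4) : ∑ j, N i j * Z j = -∑ j, C i j * (Z i - Z j) := by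
    simp only [hN, sub_mul, ite_mul, zero_mul, Finset.sum_sub_distrib, Finset.sum_ite_eq,
      Finset.mem_univ, if_true, mul_sub, Finset.sum_mul]
    ring
  have h1 (i : Fin 4) : ∑ j, N i j = 0 := by simpa using hrow (fun _ => 1) i
  have hNX (i : Fin 4) : ∑ j, N i j * X j = 0 := by rw [hrow, hX, neg_zero]
  have hNY (i : Fin 4) : ∑ j, N i j * Y j = 0 := by rw [hrow, hY, neg_zero]
  obtain ⟨u, hu⟩ := hk.exists_right_inv
  -- Proportionality of rows `i` and `k` to the areas gives `Nᵢⱼ Aₖ = Nᵢₖ Aⱼ` and `Nₖᵢ Aₖ = Nₖₖ Aᵢ`;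
  -- by symmetry `Nᵢⱼ = Nₖₖ Aₖ⁻² Aᵢ Aⱼ`.
  refine ⟨N k k * u ^ 2, fun i j hij => ?_⟩
  have e1 := mul_signedArea_comm (h1 i) (hNX i) (hNY i) j k
  have e2 := mul_signedArea_comm (h1 k) (hNX k) (hNY k) i k
  have e3 : C i j = N i j := by simp [hN, hij]
  rw [e3]
  rw [hsymm i k] at e1
  generalize signedArea X Y k = D at *
  linear_combination u * e1 - N i j * hu + signedArea X Y j * u * (u * e2 - N k i * hu)

/-- When `‖zᵢ - zⱼ‖²` is expanded, the terms involving `zᵢ` are killed by the affine relation. Hence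
the sum does not depend on `i`, which is the source of `eq₁` to `eq₄`. -/
theorem sum_signedArea_mul_sqDist (X Y : Fin 4 → S) (i : Fin 4) :
    signedArea X Y 0 * sqDist X Y i 0 + signedArea X Y 1 * sqDist X Y i 1
      + signedArea X Y 2 * sqDist X Y i 2 + signedArea X Y 3 * sqDist X Y i 3 =
    signedArea X Y 0 * (X 0 ^ 2 + Y 0 ^ 2) + signedArea X Y 1 * (X 1 ^ 2 + Y 1 ^ 2)
      + signedArea X Y 2 * (X 2 ^ 2 + Y 2 ^ 2) + signedArea X Y 3 * (X 3 ^ 2 + Y 3 ^ 2) := by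
  simp only [sqDist]
  linear_combination (X i ^ 2 + Y i ^ 2) * sum_signedArea X Y
    - 2 * X i * sum_signedArea_mul_fst X Y - 2 * Y i * sum_signedArea_mul_snd X Y

/-- The Dziobek constant of a planar equilibrium is negative. -/
theorem dziobek_neg {x y : Fin 4 → ℝ} {C : Fin 4 → Fin 4 → ℝ} {κ ν : ℝ} {g : Fin 4 → ℝ}
    (hg : ∀ i, 0 < g i) (hs : ∀ i j, i ≠ j → 0 < sqDist x y i j)
    (hC : ∀ i j, i ≠ j → C i j * sqDist x y i j = g i * g j * (1 - ν * sqDist x y i j))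
    (hκ : ∀ i j, i ≠ j → C i j = κ * (signedArea x y i * signedArea x y j))
    {k : Fin 4} (hk : signedArea x y k ≠ 0) : κ < 0 := by
  -- By `hC` the product equals `gᵢ gⱼ (1 - ν s)² / s` with `s` the squared distance.
  have hterm (i j : Fin 4) (hij : i ≠ j) : 0 ≤ C i j * (1 - ν * sqDist x y i j) ∧
      (C i j * (1 - ν * sqDist x y i j) = 0 → 1 - ν * sqDist x y i j = 0) := by
    have h1 := hC i j hij
    have hgg : 0 < g i * g j := mul_pos (hg i) (hg j)
    have h2 : C i j = g i * g j * (1 - ν * sqDist x y i j) / sqDist x y i j :=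
      eq_div_of_mul_eq (hs i j hij).ne' h1
    have h3 : C i j * (1 - ν * sqDist x y i j) =
        g i * g j / sqDist x y i j * (1 - ν * sqDist x y i j) ^ 2 := by rw [h2]; ring
    have h4 := div_pos hgg (hs i j hij)
    rw [h3]
    exact ⟨by positivity, fun h => by simpa [h4.ne'] using h⟩
  set A := signedArea x y with hA
  have a0 := sum_signedArea x y
  have aX := sum_signedArea_mul_fst x y
  have aY := sum_signedArea_mul_snd x y
  rw [← hA] at a0 aX aY
  have h01 := hterm 0 1 (by decide)
  have h02 := hterm 0 2 (by decide)
  have h03 := hterm 0 3 (by decide)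
  have h12 := hterm 1 2 (by decide)
  have h13 := hterm 1 3 (by decide)
  have h23 := hterm 2 3 (by decide)
  -- Since `∑ Aᵢ = 0`, the sum of `Aᵢ Aⱼ` over pairs is `-½ ∑ Aᵢ²`, while that of `Aᵢ Aⱼ rᵢⱼ²`
  -- vanishes. If `κ ≥ 0`, the nonnegative terms on the left must therefore all be zero.
  have hsum : C 0 1 * (1 - ν * sqDist x y 0 1) + C 0 2 * (1 - ν * sqDist x y 0 2)
      + C 0 3 * (1 - ν * sqDist x y 0 3) + C 1 2 * (1 - ν * sqDist x y 1 2)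
      + C 1 3 * (1 - ν * sqDist x y 1 3) + C 2 3 * (1 - ν * sqDist x y 2 3) =
      -(κ / 2) * (A 0 ^ 2 + A 1 ^ 2 + A 2 ^ 2 + A 3 ^ 2) := by
    rw [hκ 0 1 (by decide), hκ 0 2 (by decide), hκ 0 3 (by decide), hκ 1 2 (by decide),
      hκ 1 3 (by decide), hκ 2 3 (by decide)]
    simp only [sqDist]
    linear_combination κ / 2 * (A 0 + A 1 + A 2 + A 3) * a0
      - κ * ν * (A 0 * (x 0 ^ 2 + y 0 ^ 2) + A 1 * (x 1 ^ 2 + y 1 ^ 2)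
        + A 2 * (x 2 ^ 2 + y 2 ^ 2) + A 3 * (x 3 ^ 2 + y 3 ^ 2)) * a0
      + κ * ν * (A 0 * x 0 + A 1 * x 1 + A 2 * x 2 + A 3 * x 3) * aX
      + κ * ν * (A 0 * y 0 + A 1 * y 1 + A 2 * y 2 + A 3 * y 3) * aY
  have hpos : 0 < A 0 ^ 2 + A 1 ^ 2 + A 2 ^ 2 + A 3 ^ 2 := by
    have : 0 < A k ^ 2 := by positivity
    have := Finset.single_le_sum (f := fun i => A i ^ 2) (fun i _ => sq_nonneg _)
      (Finset.mem_univ k)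
    rw [Fin.sum_univ_four] at this
    linarith
  by_contra hneg
  have hneg' : -(κ / 2) * (A 0 ^ 2 + A 1 ^ 2 + A 2 ^ 2 + A 3 ^ 2) ≤ 0 :=
    mul_nonpos_of_nonpos_of_nonneg (by linarith) hpos.le
  have z01 := h01.2 (by linarith [h01.1, h02.1, h03.1, h12.1, h13.1, h23.1])
  have z02 := h02.2 (by linarith [h01.1, h02.1, h03.1, h12.1, h13.1, h23.1])
  have z03 := h03.2 (by linarith [h01.1, h02.1, h03.1, h12.1, h13.1, h23.1])
  have z12 := h12.2 (by linarith [h01.1, h02.1, h03.1, h12.1, h13.1, h23.1])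
  have z13 := h13.2 (by linarith [h01.1, h02.1, h03.1, h12.1, h13.1, h23.1])
  have z23 := h23.2 (by linarith [h01.1, h02.1, h03.1, h12.1, h13.1, h23.1])
  have r0 := sum_signedArea_mul_sqDist x y 0
  have r1 := sum_signedArea_mul_sqDist x y 1
  have r2 := sum_signedArea_mul_sqDist x y 2
  have r3 := sum_signedArea_mul_sqDist x y 3
  rw [← hA] at r0 r1 r2 r3
  have hcomm (i j : Fin 4) : sqDist x y i j = sqDist x y j i := by simp only [sqDist]; ring
  have hself (i : Fin 4) : sqDist x y i i = 0 := by simp [sqDist]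
  rw [hself, hcomm 1 0, hcomm 2 0, hcomm 2 1, hcomm 3 0, hcomm 3 1, hcomm 3 2] at *
  -- All squared distances are now `1/ν`, so `∑ⱼ Aⱼ rᵢⱼ²` is `-Aᵢ/ν`; being independent of `i`, it
  -- makes all areas equal, hence zero.
  have e1 : A 1 = A 0 := by
    linear_combination ν * r0 - ν * r1 + (A 1 - A 0) * z01 + A 2 * (z02 - z12) + A 3 * (z03 - z13)
  have e2 : A 2 = A 0 := by
    linear_combination ν * r0 - ν * r2 + A 1 * (z01 - z12) + (A 2 - A 0) * z02 + A 3 * (z03 - z23)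
  have e3 : A 3 = A 0 := by
    linear_combination ν * r0 - ν * r3 + A 1 * (z01 - z13) + A 2 * (z02 - z23) + (A 3 - A 0) * z03
  have e0 : A 0 = 0 := by rw [e1, e2, e3] at a0; linarith
  rw [e1, e2, e3, e0] at hpos
  norm_num at hpos

end SignedAreas

/-! ### Rigidity of non-collinear equilibria up to similarity -/

section Dual

open TrivSqZeroExt DualNumber

theorem exists_mul_self_eq {q : ℝ[ε]} (hq : 0 < q.fst) : ∃ k : ℝ[ε], k * k = q := by
  have h := (Real.sqrt_pos.2 hq).ne'
  refine ⟨inl (√q.fst) + inr (q.snd / (2 * √q.fst)), ?_⟩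
  ext
  · simp [Real.mul_self_sqrt hq.le]
  · simp only [DualNumber.snd_mul, fst_add, snd_add, fst_inl, snd_inl, fst_inr, snd_inr]
    field_simp
    ring

theorem fst_sqDist (X Y : Fin 4 → ℝ[ε]) (i j : Fin 4) :
    (sqDist X Y i j).fst = sqDist (fun i => (X i).fst) (fun i => (Y i).fst) i j := by
  simp [sqDist]

theorem fst_signedArea (X Y : Fin 4 → ℝ[ε]) (i : Fin 4) :
    (signedArea X Y i).fst = signedArea (fun i => (X i).fst) (fun i => (Y i).fst) i := by
  fin_cases i <;> simp [signedArea]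

/-- A non-collinear equilibrium of the vortices `(1, 1, m, m)` is infinitesimally rigid up to
similarity. -/
theorem snd_mul_sqDist_eq_zero {m : ℝ} (hm0 : 0 < m) (hm1 : m < 1) {X Y : Fin 4 → ℝ[ε]}
    {C : Fin 4 → Fin 4 → ℝ[ε]} {ν : ℝ[ε]} (hν : 0 < ν.fst)
    (hs : ∀ i j, i ≠ j → 0 < (sqDist X Y i j).fst)
    (hsymm : ∀ i j, C i j = C j i)
    (hC : ∀ i j, i ≠ j → C i j * sqDist X Y i j =
      inl ((pairs m hm0).val i) * inl ((pairs m hm0).val j) * (1 - ν * sqDist X Y i j))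
    (hX : ∀ i, ∑ j, C i j * (X i - X j) = 0) (hY : ∀ i, ∑ j, C i j * (Y i - Y j) = 0)
    {k : Fin 4} (hk : (signedArea X Y k).fst ≠ 0) (i j : Fin 4) (hij : i ≠ j) :
    (ν * sqDist X Y i j).snd = 0 := by
  obtain ⟨κ, hκ⟩ := exists_eq_mul_signedArea hsymm hX hY (dual_isUnit hk)
  have hκ0 : κ.fst < 0 := by
    refine dziobek_neg (x := fun i => (X i).fst) (y := fun i => (Y i).fst)
      (C := fun i j => (C i j).fst) (ν := ν.fst) (pairs m hm0).pos
      (fun i j h => by simpa only [fst_sqDist] using hs i j h) (fun i j h => ?_) (fun i j h => ?_)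
      (k := k) (by rwa [← fst_signedArea])
    · have := congrArg TrivSqZeroExt.fst (hC i j h)
      simpa only [fst_mul, fst_sub, fst_one, fst_inl, fst_sqDist] using this
    · have := congrArg TrivSqZeroExt.fst (hκ i j h)
      simpa only [fst_mul, fst_signedArea] using this
  obtain ⟨w, hw⟩ := (dual_isUnit hν.ne').exists_right_inv
  have hw0 : 0 < w.fst := by
    have := congrArg TrivSqZeroExt.fst hw
    rw [fst_mul, fst_one] at this
    exact (pos_iff_pos_of_mul_pos (by rw [this]; exact one_pos)).1 hν
  -- The negative sign of the Dziobek constant makes `r = √(-κ/ν)` available in `ℝ[ε]`; with this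
  -- factor the products `Aᵢ Aⱼ` below absorb `κ`, and `hC` becomes `ν rᵢⱼ² (1 - Aᵢ Aⱼ) = 1`.
  obtain ⟨r, hr⟩ := exists_mul_self_eq (q := -κ * w) (by
    rw [fst_mul, fst_neg]; exact mul_pos (by linarith) hw0)
  obtain ⟨A, hA⟩ : ∃ A : Fin 4 → ℝ[ε], A = fun i =>
    r * signedArea X Y i * inl ((pairs m hm0).val i)⁻¹ := ⟨_, rfl⟩
  have hgA (i : Fin 4) : inl ((pairs m hm0).val i) * A i = r * signedArea X Y i := by
    have : (inl ((pairs m hm0).val i) : ℝ[ε]) * inl ((pairs m hm0).val i)⁻¹ = 1 := by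
      rw [← inl_mul, mul_inv_cancel₀ ((pairs m hm0).pos i).ne', inl_one]
    rw [hA]
    linear_combination r * signedArea X Y i * this
  have hinv (i j : Fin 4) (h : i ≠ j) : ν * sqDist X Y i j * (1 - A i * A j) = 1 := by
    have h1 := hC i j h
    rw [hκ i j h] at h1
    have hi := hgA i
    have hj := hgA j
    have hu : (inl ((pairs m hm0).val i) * inl ((pairs m hm0).val j) : ℝ[ε]).fst ≠ 0 := by
      simp only [fst_mul, fst_inl]
      exact (mul_pos ((pairs m hm0).pos i) ((pairs m hm0).pos j)).ne'
    refine dual_mul_left_cancel hu ?_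
    have h2 : inl ((pairs m hm0).val i) * inl ((pairs m hm0).val j) * (A i * A j) =
        -κ * w * (signedArea X Y i * signedArea X Y j) := by
      rw [← hr]
      linear_combination inl ((pairs m hm0).val j) * A j * hi + r * signedArea X Y i * hj
    linear_combination -(ν * sqDist X Y i j) * h2
      + κ * (signedArea X Y i * signedArea X Y j) * sqDist X Y i j * hw + h1
  have hpos (i j : Fin 4) (h : i ≠ j) : 0 < 1 - (A i).fst * (A j).fst := by
    have := congrArg TrivSqZeroExt.fst (hinv i j h)
    simp only [fst_mul, fst_sub, fst_one] at this
    exact (pos_iff_pos_of_mul_pos (by rw [this]; exact one_pos)).1 (mul_pos hν (hs i j h))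
  have hcomm (i j : Fin 4) : sqDist X Y i j = sqDist X Y j i := by simp only [sqDist]; ring
  have hself (i : Fin 4) : sqDist X Y i i = 0 := by simp [sqDist]
  have g0 : signedArea X Y 0 * r = A 0 := by have := hgA 0; simp [pairs] at this; rw [this]; ring
  have g1 : signedArea X Y 1 * r = A 1 := by have := hgA 1; simp [pairs] at this; rw [this]; ring
  have g2 : signedArea X Y 2 * r = inl m * A 2 := by
    have := hgA 2; simp [pairs] at this; rw [this]; ring
  have g3 : signedArea X Y 3 * r = inl m * A 3 := by
    have := hgA 3; simp [pairs] at this; rw [this]; ring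
  obtain ⟨t, ht⟩ : ∃ t, ∀ i, signedArea X Y 0 * sqDist X Y i 0 + signedArea X Y 1 * sqDist X Y i 1
      + signedArea X Y 2 * sqDist X Y i 2 + signedArea X Y 3 * sqDist X Y i 3 = t :=
    ⟨_, sum_signedArea_mul_sqDist X Y⟩
  have t0 := ht 0
  have t1 := ht 1
  have t2 := ht 2
  have t3 := ht 3
  rw [hself, hcomm 1 0, hcomm 2 0, hcomm 2 1, hcomm 3 0, hcomm 3 1, hcomm 3 2] at *
  have H : AreaSystem 1 (inl m) (A 0) (A 1) (A 2) (A 3) (ν * sqDist X Y 0 1) (ν * sqDist X Y 0 2)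
      (ν * sqDist X Y 0 3) (ν * sqDist X Y 1 2) (ν * sqDist X Y 1 3) (ν * sqDist X Y 2 3)
      (ν * r * t) :=
    { sum_eq := by linear_combination r * sum_signedArea X Y - g0 - g1 - g2 - g3
      inv₁₂ := hinv 0 1 (by decide)
      inv₁₃ := hinv 0 2 (by decide)
      inv₁₄ := hinv 0 3 (by decide)
      inv₂₃ := hinv 1 2 (by decide)
      inv₂₄ := hinv 1 3 (by decide)
      inv₃₄ := hinv 2 3 (by decide)
      eq₁ := by
        linear_combination ν * (r * t0 - sqDist X Y 0 1 * g1 - sqDist X Y 0 2 * g2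
          - sqDist X Y 0 3 * g3)
      eq₂ := by
        linear_combination ν * (r * t1 - sqDist X Y 0 1 * g0 - sqDist X Y 1 2 * g2
          - sqDist X Y 1 3 * g3)
      eq₃ := by
        linear_combination ν * (r * t2 - sqDist X Y 0 2 * g0 - sqDist X Y 1 2 * g1
          - sqDist X Y 2 3 * g3)
      eq₄ := by
        linear_combination ν * (r * t3 - sqDist X Y 0 3 * g0 - sqDist X Y 1 3 * g1
          - sqDist X Y 2 3 * g2) }
  obtain ⟨z0, z1, z2, z3⟩ := H.snd_eq_zero hm0 hm1 (hpos 0 1 (by decide)) (hpos 0 2 (by decide))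
    (hpos 0 3 (by decide)) (hpos 1 2 (by decide)) (hpos 2 3 (by decide))
  have hz : ∀ i, (A i).snd = 0 := fun i => by fin_cases i <;> assumption
  have := congrArg TrivSqZeroExt.snd (hinv i j hij)
  rw [DualNumber.snd_mul, snd_sub, DualNumber.snd_mul (A i), hz i, hz j, snd_one, fst_sub,
    fst_mul (A i), fst_one] at this
  have h0 : (ν * sqDist X Y i j).snd * (1 - (A i).fst * (A j).fst) = 0 := by
    linear_combination this
  exact (mul_eq_zero.1 h0).resolve_right (hpos i j hij).ne'

end Dual

/-! ### Maximum principles for collinear equilibria -/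

section Collinear

variable {ι : Type*} [Fintype ι] {f g : ι → ℝ} {ν : ℝ}

/-- A discrete maximum principle. -/
theorem eq_of_sum_pos_mul_sub_eq_zero {c : ι → ι → ℝ} {x : ι → ℝ} (hc : ∀ i j, 0 < c i j)
    (h : ∀ i, ∑ j, c i j * (x i - x j) = 0) (i j : ι) : x i = x j := by
  obtain ⟨k, -, hk⟩ := Finset.exists_max_image Finset.univ x ⟨i, Finset.mem_univ i⟩
  have hnn : ∀ j ∈ Finset.univ, 0 ≤ c k j * (x k - x j) := fun j hj =>
    mul_nonneg (hc k j).le (sub_nonneg.2 (hk j hj))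
  have key (j : ι) : x k = x j := by
    have := (Finset.sum_eq_zero_iff_of_nonneg hnn).1 (h k) j (Finset.mem_univ j)
    exact sub_eq_zero.1 ((mul_eq_zero.1 this).resolve_left (hc k j).ne')
  rw [← key i, ← key j]

/-- The transversal linearization at a collinear equilibrium has only the trivial solutions. -/
theorem exists_sub_eq_mul_of_collinear [Nontrivial ι] {y : ι → ℝ} (hf : Function.Injective f)
    (hg : ∀ i, 0 < g i)
    (hF : ∀ i, ∑ j, g j * (((f i - f j) ^ 2)⁻¹ - ν) * (f i - f j) = 0)
    (hy : ∀ i, ∑ j, g j * (((f i - f j) ^ 2)⁻¹ - ν) * (y i - y j) = 0) :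
    ∃ R : ℝ, ∀ i j, y i - y j = R * (f i - f j) := by
  classical
  obtain ⟨a, b, hab⟩ := exists_pair_ne ι
  obtain ⟨⟨i, j⟩, hij, hmax⟩ := Finset.exists_max_image (Finset.univ : Finset ι).offDiag
    (fun p => (y p.1 - y p.2) / (f p.1 - f p.2)) ⟨(a, b), by simpa using hab⟩
  wlog hlt : f j < f i generalizing i j
  · have hne : i ≠ j := by simpa using hij
    refine this j i (by simpa using hne.symm) (fun p hp => (hmax p hp).trans_eq ?_)
      (lt_of_le_of_ne (not_lt.1 hlt) (hf.ne hne))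
    change (y i - y j) / (f i - f j) = (y j - y i) / (f j - f i)
    rw [← neg_sub (y j), ← neg_sub (f j), neg_div_neg_eq]
  obtain ⟨R, hR⟩ : ∃ R, R = (y i - y j) / (f i - f j) := ⟨_, rfl⟩
  -- As `R` is the largest slope, `w = y - R f` is nonincreasing along the line; it is constant
  -- between `j` and `i`, where it takes equal values.
  have hmax' (k l : ι) (hkl : f l < f k) : y k - R * f k ≤ y l - R * f l := by
    have hne : k ≠ l := by rintro rfl; exact lt_irrefl _ hkl
    have h1 : (y k - y l) / (f k - f l) ≤ R := by
      rw [hR]; exact hmax (k, l) (by simpa using hne)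
    rw [div_le_iff₀ (sub_pos.2 hkl)] at h1
    linarith
  obtain ⟨w, hw⟩ : ∃ w : ι → ℝ, w = fun k => y k - R * f k := ⟨_, rfl⟩
  have hmono (k l : ι) (hkl : f l < f k) : w k ≤ w l := by rw [hw]; exact hmax' k l hkl
  have hwij : w i = w j := by
    have : y i - y j = R * (f i - f j) := by
      rw [hR, div_mul_cancel₀ _ (sub_pos.2 hlt).ne']
    rw [hw]; dsimp only; linarith
  have hwE (i : ι) : ∑ k, g k * (((f i - f k) ^ 2)⁻¹ - ν) * (w i - w k) = 0 := by
    have : ∑ k, g k * (((f i - f k) ^ 2)⁻¹ - ν) * (w i - w k) =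
        ∑ k, g k * (((f i - f k) ^ 2)⁻¹ - ν) * (y i - y k) -
        R * ∑ k, g k * (((f i - f k) ^ 2)⁻¹ - ν) * (f i - f k) := by
      rw [Finset.mul_sum, ← Finset.sum_sub_distrib]
      exact Finset.sum_congr rfl fun k _ => by rw [hw]; ring
    rw [this, hy, hF, mul_zero, sub_zero]
  -- Because `w i = w j`, subtracting the equations at `i` and `j` cancels `ν`. The remaining terms
  -- are nonnegative: vortices to the right of `i` are closer to `i`, those to the left of `j` are
  -- closer to `j`, and those between contribute nothing.
  have hdiff : ∑ k, g k * ((((f i - f k) ^ 2)⁻¹ - ((f j - f k) ^ 2)⁻¹) * (w i - w k)) = 0 := by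
    have : ∑ k, g k * ((((f i - f k) ^ 2)⁻¹ - ((f j - f k) ^ 2)⁻¹) * (w i - w k)) =
        ∑ k, g k * (((f i - f k) ^ 2)⁻¹ - ν) * (w i - w k) -
        ∑ k, g k * (((f j - f k) ^ 2)⁻¹ - ν) * (w j - w k) := by
      rw [← Finset.sum_sub_distrib]
      exact Finset.sum_congr rfl fun k _ => by rw [hwij]; ring
    rw [this, hwE, hwE, sub_zero]
  have hright {k : ι} (hk : f i < f k) : ((f j - f k) ^ 2)⁻¹ < ((f i - f k) ^ 2)⁻¹ := by
    have h1 : 0 < (f i - f k) ^ 2 := sq_pos_of_ne_zero (sub_ne_zero.2 hk.ne)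
    exact inv_strictAnti₀ h1 (by nlinarith)
  have hleft {k : ι} (hk : f k < f j) : ((f i - f k) ^ 2)⁻¹ < ((f j - f k) ^ 2)⁻¹ := by
    have h1 : 0 < (f j - f k) ^ 2 := sq_pos_of_ne_zero (sub_ne_zero.2 hk.ne')
    exact inv_strictAnti₀ h1 (by nlinarith)
  have hmid (k : ι) : f i < f k ∨ f k < f j ∨ w i = w k := by
    by_cases h1 : f i < f k
    · exact Or.inl h1
    by_cases h2 : f k < f j
    · exact Or.inr (Or.inl h2)
    refine Or.inr (Or.inr ?_)
    rcases (not_lt.1 h1).lt_or_eq with h3 | h3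
    · rcases (not_lt.1 h2).lt_or_eq with h4 | h4
      · exact le_antisymm (hmono i k h3) (hwij ▸ hmono k j h4)
      · rw [hwij, hf h4]
    · rw [hf h3]
  have hnn : ∀ k ∈ Finset.univ,
      0 ≤ g k * ((((f i - f k) ^ 2)⁻¹ - ((f j - f k) ^ 2)⁻¹) * (w i - w k)) := by
    intro k _
    refine mul_nonneg (hg k).le ?_
    rcases hmid k with h | h | h
    · exact mul_nonneg (sub_nonneg.2 (hright h).le) (sub_nonneg.2 (hmono k i h))
    · exact mul_nonneg_of_nonpos_of_nonpos (sub_nonpos.2 (hleft h).le)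
        (sub_nonpos.2 (hwij ▸ hmono j k h))
    · rw [h, sub_self, mul_zero]
  have hconst (k : ι) : w i = w k := by
    have h0 := (Finset.sum_eq_zero_iff_of_nonneg hnn).1 hdiff k (Finset.mem_univ k)
    have h1 := (mul_eq_zero.1 h0).resolve_left (hg k).ne'
    rcases hmid k with h | h | h
    · exact sub_eq_zero.1 ((mul_eq_zero.1 h1).resolve_left (sub_pos.2 (hright h)).ne')
    · exact sub_eq_zero.1 ((mul_eq_zero.1 h1).resolve_left (sub_neg.2 (hleft h)).ne)
    · exact h
  refine ⟨R, fun k l => ?_⟩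
  have := (hconst k).symm.trans (hconst l)
  rw [hw] at this
  dsimp only at this
  linarith

end Collinear

/-! ### Infinitesimal rigidity of all equilibria -/

section Dual

open TrivSqZeroExt DualNumber

variable {m : ℝ} {X Y : Fin 4 → ℝ[ε]} {C : Fin 4 → Fin 4 → ℝ[ε]} {ν : ℝ[ε]}

/-- By invariance under similarities, two of the four equilibrium equations are redundant. -/
theorem equilibrium_of_last {S : Type*} [CommRing S] {X Y : Fin 4 → S} {C : Fin 4 → Fin 4 → S}
    (hsymm : ∀ i j, C i j = C j i)
    (hX0 : X 0 = 0) (hY0 : Y 0 = 0) (hX1 : X 1 = 1) (hY1 : Y 1 = 0)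
    (hscale : C 0 1 * sqDist X Y 0 1 + C 0 2 * sqDist X Y 0 2 + C 0 3 * sqDist X Y 0 3
      + C 1 2 * sqDist X Y 1 2 + C 1 3 * sqDist X Y 1 3 + C 2 3 * sqDist X Y 2 3 = 0)
    (hX2 : ∑ j, C 2 j * (X 2 - X j) = 0) (hY2 : ∑ j, C 2 j * (Y 2 - Y j) = 0)
    (hX3 : ∑ j, C 3 j * (X 3 - X j) = 0) (hY3 : ∑ j, C 3 j * (Y 3 - Y j) = 0) :
    (∀ i, ∑ j, C i j * (X i - X j) = 0) ∧ ∀ i, ∑ j, C i j * (Y i - Y j) = 0 := by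
  simp only [Fin.sum_univ_four, sqDist, hX0, hX1, hY0, hY1] at hscale hX2 hY2 hX3 hY3 ⊢
  rw [hsymm 2 0, hsymm 2 1] at hX2 hY2
  rw [hsymm 3 0, hsymm 3 1, hsymm 3 2] at hX3 hY3
  -- Scale invariance, `∑ zᵢ · Fᵢ = 0`, yields the first component at the vortex `(1, 0)`. Vanishing
  -- total torque yields the second, and vanishing total force yields the equations at the origin.
  have x1 : C 1 0 * (1 - 0) + C 1 1 * (1 - 1) + C 1 2 * (1 - X 2) + C 1 3 * (1 - X 3) = 0 := by
    rw [hsymm 1 0]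
    linear_combination hscale - X 2 * hX2 - Y 2 * hY2 - X 3 * hX3 - Y 3 * hY3
  have y1 : C 1 0 * (0 - 0) + C 1 1 * (0 - 0) + C 1 2 * (0 - Y 2) + C 1 3 * (0 - Y 3) = 0 := by
    linear_combination -X 2 * hY2 + Y 2 * hX2 - X 3 * hY3 + Y 3 * hX3
  rw [hsymm 1 0] at x1
  constructor <;> intro i <;> fin_cases i
  · simp only [Fin.zero_eta, Fin.isValue, hX0]
    linear_combination -hX2 - hX3 - x1
  · simp only [Fin.mk_one, Fin.isValue, hX1, hsymm 1 0]
    linear_combination x1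
  · simp only [Fin.reduceFinMk, Fin.isValue, hsymm 2 0, hsymm 2 1]
    linear_combination hX2
  · simp only [Fin.reduceFinMk, Fin.isValue, hsymm 3 0, hsymm 3 1, hsymm 3 2]
    linear_combination hX3
  · simp only [Fin.zero_eta, Fin.isValue, hY0]
    linear_combination -hY2 - hY3 - y1
  · simp only [Fin.mk_one, Fin.isValue, hY1]
    linear_combination y1
  · simp only [Fin.reduceFinMk, Fin.isValue, hsymm 2 0, hsymm 2 1]
    linear_combination hY2
  · simp only [Fin.reduceFinMk, Fin.isValue, hsymm 3 0, hsymm 3 1, hsymm 3 2]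
    linear_combination hY3

/-- Collinear equilibria are infinitesimally rigid. -/
theorem snd_eq_zero_of_collinear {g : Fin 4 → ℝ} (hg : ∀ i, 0 < g i) (hν : 0 < ν.fst)
    (hs : ∀ i j, i ≠ j → 0 < (sqDist X Y i j).fst)
    (hC : ∀ i j, i ≠ j → C i j * sqDist X Y i j =
      inl (g i) * inl (g j) * (1 - ν * sqDist X Y i j))
    (hX : ∀ i, ∑ j, C i j * (X i - X j) = 0) (hY : ∀ i, ∑ j, C i j * (Y i - Y j) = 0)
    (hX0 : X 0 = 0) (hY0 : Y 0 = 0) (hX1 : X 1 = 1) (hY1 : Y 1 = 0) (hcol : ∀ i, (Y i).fst = 0) :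
    ∀ i, (X i).snd = 0 ∧ (Y i).snd = 0 := by
  have hsq (i j : Fin 4) : (sqDist X Y i j).fst = ((X i).fst - (X j).fst) ^ 2 := by
    simp [sqDist, hcol]
  have hsq' (i j : Fin 4) : (sqDist X Y i j).snd =
      2 * (((X i).fst - (X j).fst) * ((X i).snd - (X j).snd)) := by
    simp only [sqDist, sq, snd_add, DualNumber.snd_mul, snd_sub, fst_sub, hcol]
    ring
  have hinj : Function.Injective fun i => (X i).fst := fun i j h => by
    by_contra hij
    have := hs i j hij
    rw [hsq] at this
    simp only at h
    simp [h] at this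
  have hC0 (i j : Fin 4) (hij : i ≠ j) :
      (C i j).fst = g i * (g j * ((((X i).fst - (X j).fst) ^ 2)⁻¹ - ν.fst)) := by
    have h1 := congrArg TrivSqZeroExt.fst (hC i j hij)
    simp only [fst_mul, fst_sub, fst_one, fst_inl, hsq] at h1
    have h2 := (hs i j hij).ne'
    rw [hsq] at h2
    generalize ((X i).fst - (X j).fst) ^ 2 = s at *
    field_simp
    linear_combination h1
  have hC1 (i j : Fin 4) (hij : i ≠ j) : (C i j).snd * ((X i).fst - (X j).fst) =
      -(g i * (g j * (ν.snd * ((X i).fst - (X j).fst)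
        + 2 * (((X i).fst - (X j).fst) ^ 2)⁻¹ * ((X i).snd - (X j).snd)))) := by
    have h1 := congrArg TrivSqZeroExt.snd (hC i j hij)
    simp only [DualNumber.snd_mul, snd_sub, snd_one, snd_inl, fst_mul, fst_sub, fst_one, fst_inl,
      hsq, hsq'] at h1
    rw [hC0 i j hij] at h1
    have h2 : (X i).fst - (X j).fst ≠ 0 := sub_ne_zero.2 (hinj.ne hij)
    generalize (X i).fst - (X j).fst = d at *
    field_simp at h1 ⊢
    linear_combination h1
  have hF (i : Fin 4) : ∑ j, g j * ((((X i).fst - (X j).fst) ^ 2)⁻¹ - ν.fst) *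
      ((X i).fst - (X j).fst) = 0 := by
    have h1 := congrArg TrivSqZeroExt.fst (hX i)
    rw [fst_sum, fst_zero] at h1
    refine (mul_eq_zero.1 (?_ : g i * _ = 0)).resolve_left (hg i).ne'
    rw [Finset.mul_sum, ← h1]
    refine Finset.sum_congr rfl fun j _ => ?_
    rcases eq_or_ne i j with rfl | hij
    · simp
    · rw [fst_mul, fst_sub, hC0 i j hij]; ring
  have hy (i : Fin 4) : ∑ j, g j * ((((X i).fst - (X j).fst) ^ 2)⁻¹ - ν.fst) *
      ((Y i).snd - (Y j).snd) = 0 := by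
    have h1 := congrArg TrivSqZeroExt.snd (hY i)
    rw [snd_sum, snd_zero] at h1
    refine (mul_eq_zero.1 (?_ : g i * _ = 0)).resolve_left (hg i).ne'
    rw [Finset.mul_sum, ← h1]
    refine Finset.sum_congr rfl fun j _ => ?_
    rcases eq_or_ne i j with rfl | hij
    · simp
    · rw [DualNumber.snd_mul, fst_sub, snd_sub, hC0 i j hij, hcol, hcol]; ring
  -- Differentiating `d⁻¹ - ν d` turns the coefficient into `-(d⁻² + ν)`, which has a definite sign.
  -- The term with `ν.snd` is absorbed by the shift along `X`, since `hF` gives `∑ g (d⁻² + ν) d =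
  -- 2ν ∑ g d`.
  have hx (i : Fin 4) : ∑ j, g j * ((((X i).fst - (X j).fst) ^ 2)⁻¹ + ν.fst) *
      (((X i).snd + ν.snd / (2 * ν.fst) * (X i).fst) -
        ((X j).snd + ν.snd / (2 * ν.fst) * (X j).fst)) = 0 := by
    have h1 := congrArg TrivSqZeroExt.snd (hX i)
    rw [snd_sum, snd_zero] at h1
    refine (mul_eq_zero.1 (?_ : g i * _ = 0)).resolve_left (hg i).ne'
    have h2 : g i * (∑ j, g j * ((((X i).fst - (X j).fst) ^ 2)⁻¹ + ν.fst) *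
      (((X i).snd + ν.snd / (2 * ν.fst) * (X i).fst) -
        ((X j).snd + ν.snd / (2 * ν.fst) * (X j).fst))) =
      g i * (ν.snd / (2 * ν.fst)) * (∑ j, g j * ((((X i).fst - (X j).fst) ^ 2)⁻¹ - ν.fst) *
      ((X i).fst - (X j).fst)) - ∑ j, (C i j * (X i - X j)).snd := by
      rw [Finset.mul_sum, Finset.mul_sum, ← Finset.sum_sub_distrib]
      refine Finset.sum_congr rfl fun j _ => ?_
      rcases eq_or_ne i j with rfl | hij
      · simp
      · rw [DualNumber.snd_mul, fst_sub, snd_sub, hC1 i j hij, hC0 i j hij]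
        have := hν.ne'
        generalize (((X i).fst - (X j).fst) ^ 2)⁻¹ = e
        field_simp
        ring
    rw [h2, hF, h1]
    ring
  obtain ⟨R, hR⟩ := exists_sub_eq_mul_of_collinear hinj hg hF hy
  have hc := eq_of_sum_pos_mul_sub_eq_zero
    (c := fun i j => g j * ((((X i).fst - (X j).fst) ^ 2)⁻¹ + ν.fst))
    (x := fun i => (X i).snd + ν.snd / (2 * ν.fst) * (X i).fst)
    (fun i j => mul_pos (hg j) (by positivity)) hx
  -- The fixed points `0` and `1` rule out infinitesimal rotation (`R`) and dilation (`hα`).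
  have hR0 : R = 0 := by simpa [hX0, hX1, hY0, hY1] using (hR 1 0).symm
  have hα : ν.snd / (2 * ν.fst) = 0 := by
    have := hc 1 0
    simpa only [hX0, hX1, snd_one, snd_zero, fst_one, fst_zero, mul_one, mul_zero, add_zero,
      zero_add] using this
  intro i
  constructor
  · have := hc i 0
    simpa only [hα, hX0, snd_zero, zero_mul, add_zero] using this
  · have := hR i 0
    simpa only [hR0, hY0, snd_zero, zero_mul, sub_zero] using this

/-- All equilibria of the vortices `(1, 1, m, m)`, `0 < m < 1`, are infinitesimally rigid. -/
theorem snd_eq_zero_of_equilibrium (hm0 : 0 < m) (hm1 : m < 1) (hν : 0 < ν.fst)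
    (hs : ∀ i j, i ≠ j → 0 < (sqDist X Y i j).fst)
    (hsymm : ∀ i j, C i j = C j i)
    (hC : ∀ i j, i ≠ j → C i j * sqDist X Y i j =
      inl ((pairs m hm0).val i) * inl ((pairs m hm0).val j) * (1 - ν * sqDist X Y i j))
    (hX : ∀ i, ∑ j, C i j * (X i - X j) = 0) (hY : ∀ i, ∑ j, C i j * (Y i - Y j) = 0)
    (hX0 : X 0 = 0) (hY0 : Y 0 = 0) (hX1 : X 1 = 1) (hY1 : Y 1 = 0) :
    ∀ i, (X i).snd = 0 ∧ (Y i).snd = 0 := by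
  by_cases hcol : (Y 2).fst = 0 ∧ (Y 3).fst = 0
  · refine snd_eq_zero_of_collinear (pairs m hm0).pos hν hs hC hX hY hX0 hY0 hX1 hY1 fun i => ?_
    fin_cases i
    · simp [hY0]
    · simp [hY1]
    · exact hcol.1
    · exact hcol.2
  have hS : ∀ i j, i ≠ j → (sqDist X Y i j).snd = 0 := by
    have key : ∀ i j, i ≠ j → (ν * sqDist X Y i j).snd = 0 := by
      -- With the first two points at `0` and `1`, the signed area of index 2 is `Y 3` and that of
      -- index 3 is `-Y 2`.
      by_cases h2 : (Y 2).fst = 0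
      · refine snd_mul_sqDist_eq_zero hm0 hm1 hν hs hsymm hC hX hY (k := 2) ?_
        simpa [signedArea, hX0, hX1, hY0, hY1] using fun h => hcol ⟨h2, h⟩
      · refine snd_mul_sqDist_eq_zero hm0 hm1 hν hs hsymm hC hX hY (k := 3) ?_
        simpa [signedArea, hX0, hX1, hY0, hY1] using h2
    have hν1 : ν.snd = 0 := by
      have := key 0 1 (by decide)
      simpa [sqDist, hX0, hX1, hY0, hY1] using this
    intro i j hij
    have := key i j hij
    rw [DualNumber.snd_mul, hν1, zero_mul, add_zero] at this
    exact (mul_eq_zero.1 this).resolve_left hν.ne'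
  have e02 := hS 0 2 (by decide)
  have e12 := hS 1 2 (by decide)
  have e03 := hS 0 3 (by decide)
  have e13 := hS 1 3 (by decide)
  have e23 := hS 2 3 (by decide)
  simp only [sqDist, sq, snd_add, DualNumber.snd_mul, snd_sub, fst_sub, hX0, hX1, hY0, hY1,
    fst_zero, snd_zero, fst_one, snd_one] at e02 e12 e03 e13 e23
  have x2 : (X 2).snd = 0 := by linarith
  have x3 : (X 3).snd = 0 := by linarith
  have y2 : (Y 2).fst * (Y 2).snd = 0 := by rw [x2] at e02; linarith
  have y3 : (Y 3).fst * (Y 3).snd = 0 := by rw [x3] at e03; linarith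
  rw [x2, x3] at e23
  have y23 : (Y 2).fst * (Y 3).snd + (Y 3).fst * (Y 2).snd = 0 := by linarith
  -- A point on the real axis has distances to `0` and `1` that are stationary under vertical
  -- motion; its distance to the other, off-axis point excludes that motion.
  have hy : (Y 2).snd = 0 ∧ (Y 3).snd = 0 := by
    by_cases h2 : (Y 2).fst = 0
    · have h3 : (Y 3).fst ≠ 0 := fun h => hcol ⟨h2, h⟩
      have z3 := (mul_eq_zero.1 y3).resolve_left h3
      rw [z3, mul_zero, zero_add] at y23
      exact ⟨(mul_eq_zero.1 y23).resolve_left h3, z3⟩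
    · have z2 := (mul_eq_zero.1 y2).resolve_left h2
      rw [z2, mul_zero, add_zero] at y23
      exact ⟨z2, (mul_eq_zero.1 y23).resolve_left h2⟩
  intro i
  fin_cases i
  · simp [hX0, hY0]
  · simp [hX1, hY1]
  · exact ⟨x2, hy.1⟩
  · exact ⟨x3, hy.2⟩

end Dual

/-! ### Sums over pairs and the coefficients of the equilibrium equations -/

section Couplings

/-- The sum over all pairs of four vortices. -/
def pairSum {S : Type*} [Add S] (f : Fin 4 → Fin 4 → S) : S :=
  f 0 1 + f 0 2 + f 0 3 + f 1 2 + f 1 3 + f 2 3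

theorem sum_Ioi_eq_pairSum {S : Type*} [AddCommMonoid S] (f : Fin 4 → Fin 4 → S) :
    ∑ i, ∑ j ∈ Finset.Ioi i, f i j = pairSum f := by
  have h0 : Finset.Ioi (0 : Fin 4) = {1, 2, 3} := by decide
  have h1 : Finset.Ioi (1 : Fin 4) = {2, 3} := by decide
  have h2 : Finset.Ioi (2 : Fin 4) = {3} := by decide
  have h3 : Finset.Ioi (3 : Fin 4) = ∅ := by decide
  rw [Fin.sum_univ_four, h0, h1, h2, h3]
  simp [pairSum, add_assoc]

theorem pairSum_congr {S : Type*} [Add S] {f g : Fin 4 → Fin 4 → S}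
    (h : ∀ i j, i ≠ j → f i j = g i j) : pairSum f = pairSum g := by
  simp only [pairSum, h 0 1 (by decide), h 0 2 (by decide), h 0 3 (by decide), h 1 2 (by decide),
    h 1 3 (by decide), h 2 3 (by decide)]

theorem pairSum_pos {f : Fin 4 → Fin 4 → ℝ} (h : ∀ i j, i ≠ j → 0 < f i j) : 0 < pairSum f := by
  have := h 0 1 (by decide)
  have := h 0 2 (by decide)
  have := h 0 3 (by decide)
  have := h 1 2 (by decide)
  have := h 1 3 (by decide)
  have := h 2 3 (by decide)
  simp only [pairSum]
  positivity

variable {S : Type*} [CommRing S] [Inv S]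

/-- The multiplier `L / J`, where `L = ∑ Γᵢ Γⱼ` and `J = ∑ Γᵢ Γⱼ rᵢⱼ²`. -/
def multiplier (g X Y : Fin 4 → S) : S :=
  pairSum (fun i j => g i * g j) * (pairSum fun i j => g i * g j * sqDist X Y i j)⁻¹

/-- The coefficients `Γᵢ Γⱼ (rᵢⱼ⁻² - L / J)` of the equilibrium equations. -/
def coupling (g X Y : Fin 4 → S) (i j : Fin 4) : S :=
  if i = j then 0 else g i * g j * ((sqDist X Y i j)⁻¹ - multiplier g X Y)

theorem sqDist_comm {S : Type*} [CommRing S] (X Y : Fin 4 → S) (i j : Fin 4) :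
    sqDist X Y i j = sqDist X Y j i := by
  simp only [sqDist]; ring

theorem coupling_comm (g X Y : Fin 4 → S) (i j : Fin 4) :
    coupling g X Y i j = coupling g X Y j i := by
  simp only [coupling, eq_comm (a := i), mul_comm (g i), sqDist_comm X Y i]

end Couplings

/-! ### First-order jets of curves as dual numbers -/

section Jets

open TrivSqZeroExt DualNumber

/-- `A` is the first-order jet at `0` of the curve `φ`. -/
def Jet (φ : ℝ → ℝ) (A : ℝ[ε]) : Prop := φ 0 = A.fst ∧ HasDerivAt φ A.snd 0

namespace Jet

variable {φ ψ : ℝ → ℝ} {A B : ℝ[ε]}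

theorem const (c : ℝ) : Jet (fun _ => c) (inl c) :=
  ⟨by simp, by simpa using hasDerivAt_const (0 : ℝ) c⟩

theorem zero : Jet (fun _ => 0) 0 := by simpa using const 0

theorem add (h : Jet φ A) (h' : Jet ψ B) : Jet (fun t => φ t + ψ t) (A + B) :=
  ⟨by simp [h.1, h'.1], by simpa using h.2.fun_add h'.2⟩

theorem sub (h : Jet φ A) (h' : Jet ψ B) : Jet (fun t => φ t - ψ t) (A - B) :=
  ⟨by simp [h.1, h'.1], by simpa using h.2.fun_sub h'.2⟩

theorem mul (h : Jet φ A) (h' : Jet ψ B) : Jet (fun t => φ t * ψ t) (A * B) := by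
  refine ⟨by simp [h.1, h'.1], ?_⟩
  have := h.2.fun_mul h'.2
  rw [h.1, h'.1] at this
  rw [DualNumber.snd_mul, add_comm]
  exact this

theorem sq (h : Jet φ A) : Jet (fun t => φ t ^ 2) (A ^ 2) := by
  simpa only [pow_two] using h.mul h

theorem inv (h : Jet φ A) (hA : A.fst ≠ 0) : Jet (fun t => (φ t)⁻¹) A⁻¹ := by
  refine ⟨by simp [h.1], ?_⟩
  have := h.2.fun_inv (by rwa [h.1])
  rw [h.1] at this
  refine this.congr_deriv ?_
  rw [snd_inv, op_smul_eq_mul, smul_eq_mul]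
  field_simp

theorem sum {ι : Type*} {s : Finset ι} {φ : ι → ℝ → ℝ} {A : ι → ℝ[ε]}
    (h : ∀ i ∈ s, Jet (φ i) (A i)) : Jet (fun t => ∑ i ∈ s, φ i t) (∑ i ∈ s, A i) := by
  refine ⟨?_, ?_⟩
  · rw [fst_sum]; exact Finset.sum_congr rfl fun i hi => (h i hi).1
  · rw [snd_sum]; exact HasDerivAt.fun_sum fun i hi => (h i hi).2

/-- The passage from calculus to algebra: an equation that holds at `0` and has vanishing derivative
there becomes an exact equation in `ℝ[ε]`. -/
theorem eq_zero (h : Jet φ A) (h0 : φ 0 = 0) (h1 : HasDerivAt φ 0 0) : A = 0 := by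
  ext
  · rw [← h.1, h0, fst_zero]
  · rw [h.2.unique h1, snd_zero]

theorem pairSum {φ : Fin 4 → Fin 4 → ℝ → ℝ} {A : Fin 4 → Fin 4 → ℝ[ε]}
    (h : ∀ i j, Jet (φ i j) (A i j)) :
    Jet (fun t => Vortex.pairSum fun i j => φ i j t) (Vortex.pairSum A) :=
  (((((h 0 1).add (h 0 2)).add (h 0 3)).add (h 1 2)).add (h 1 3)).add (h 2 3)

variable {x y : ℝ → Fin 4 → ℝ} {X Y : Fin 4 → ℝ[ε]}

theorem sqDist (hx : ∀ i, Jet (fun t => x t i) (X i)) (hy : ∀ i, Jet (fun t => y t i) (Y i))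
    (i j : Fin 4) : Jet (fun t => Vortex.sqDist (x t) (y t) i j) (Vortex.sqDist X Y i j) :=
  ((hx i).sub (hx j)).sq.add ((hy i).sub (hy j)).sq

theorem multiplier {g : Fin 4 → ℝ} (hg : ∀ i, 0 < g i)
    (hx : ∀ i, Jet (fun t => x t i) (X i)) (hy : ∀ i, Jet (fun t => y t i) (Y i))
    (hs : ∀ i j, i ≠ j → 0 < (Vortex.sqDist X Y i j).fst) :
    Jet (fun t => Vortex.multiplier g (x t) (y t)) (Vortex.multiplier (fun i => inl (g i)) X Y) := by
  refine (pairSum fun i j => (const _).mul (const _)).mul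
    ((pairSum fun i j => ((const _).mul (const _)).mul (sqDist hx hy i j)).inv ?_)
  have : 0 < Vortex.pairSum fun i j => g i * g j * (Vortex.sqDist X Y i j).fst :=
    pairSum_pos fun i j h => mul_pos (mul_pos (hg i) (hg j)) (hs i j h)
  simpa [Vortex.pairSum] using this.ne'

theorem coupling {g : Fin 4 → ℝ} (hg : ∀ i, 0 < g i)
    (hx : ∀ i, Jet (fun t => x t i) (X i)) (hy : ∀ i, Jet (fun t => y t i) (Y i))
    (hs : ∀ i j, i ≠ j → 0 < (Vortex.sqDist X Y i j).fst) (i j : Fin 4) :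
    Jet (fun t => Vortex.coupling g (x t) (y t) i j)
      (Vortex.coupling (fun i => inl (g i)) X Y i j) := by
  by_cases h : i = j
  · simpa [Vortex.coupling, h] using zero
  · simp only [Vortex.coupling, if_neg h]
    exact ((const _).mul (const _)).mul
      (((sqDist hx hy i j).inv (hs i j h).ne').sub (multiplier hg hx hy hs))

end Jet

/-- A critical configuration whose first-order jet also solves the equilibrium equations of the
last two vortices is infinitesimally rigid. -/
theorem snd_eq_zero_of_coupling {m : ℝ} (hm0 : 0 < m) (hm1 : m < 1) {X Y : Fin 4 → ℝ[ε]}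
    (hs : ∀ i j, i ≠ j → 0 < (sqDist X Y i j).fst)
    (hX0 : X 0 = 0) (hY0 : Y 0 = 0) (hX1 : X 1 = 1) (hY1 : Y 1 = 0)
    (hX : ∀ k : Fin 2, ∑ j, coupling (fun i => inl ((pairs m hm0).val i)) X Y k.succ.succ j *
      (X k.succ.succ - X j) = 0)
    (hY : ∀ k : Fin 2, ∑ j, coupling (fun i => inl ((pairs m hm0).val i)) X Y k.succ.succ j *
      (Y k.succ.succ - Y j) = 0) :
    ∀ i, (X i).snd = 0 ∧ (Y i).snd = 0 := by
  set g := (pairs m hm0).val with hg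
  have hgpos := (pairs m hm0).pos
  rw [← hg] at hgpos
  have hJ : 0 < (pairSum fun i j => inl (g i) * inl (g j) * sqDist X Y i j : ℝ[ε]).fst := by
    have : 0 < pairSum fun i j => g i * g j * (sqDist X Y i j).fst :=
      pairSum_pos fun i j h => mul_pos (mul_pos (hgpos i) (hgpos j)) (hs i j h)
    simpa [pairSum] using this
  have hν : 0 < (multiplier (fun i => inl (g i)) X Y).fst := by
    rw [multiplier, fst_mul, fst_inv]
    refine mul_pos ?_ (inv_pos.2 hJ)
    have : 0 < pairSum fun i j => g i * g j := pairSum_pos fun i j _ => mul_pos (hgpos i) (hgpos j)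
    simpa [pairSum] using this
  have hC (i j : Fin 4) (hij : i ≠ j) : coupling (fun i => inl (g i)) X Y i j * sqDist X Y i j =
      inl (g i) * inl (g j) * (1 - multiplier (fun i => inl (g i)) X Y * sqDist X Y i j) := by
    have h1 := TrivSqZeroExt.inv_mul_cancel (hs i j hij).ne'
    rw [coupling, if_neg hij]
    linear_combination inl (g i) * inl (g j) * h1
  -- The multiplier `ν = L / J` is the one for which `∑ Cᵢⱼ rᵢⱼ² = L - ν J` vanishes.
  have hscale : coupling (fun i => inl (g i)) X Y 0 1 * sqDist X Y 0 1
      + coupling (fun i => inl (g i)) X Y 0 2 * sqDist X Y 0 2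
      + coupling (fun i => inl (g i)) X Y 0 3 * sqDist X Y 0 3
      + coupling (fun i => inl (g i)) X Y 1 2 * sqDist X Y 1 2
      + coupling (fun i => inl (g i)) X Y 1 3 * sqDist X Y 1 3
      + coupling (fun i => inl (g i)) X Y 2 3 * sqDist X Y 2 3 = 0 := by
    rw [hC 0 1 (by decide), hC 0 2 (by decide), hC 0 3 (by decide), hC 1 2 (by decide),
      hC 1 3 (by decide), hC 2 3 (by decide)]
    have h1 := TrivSqZeroExt.inv_mul_cancel hJ.ne'
    rw [multiplier]
    generalize (pairSum fun i j => inl (g i) * inl (g j) * sqDist X Y i j : ℝ[ε])⁻¹ = w at h1 ⊢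
    simp only [pairSum] at h1 ⊢
    linear_combination -(inl (g 0) * inl (g 1) + inl (g 0) * inl (g 2) + inl (g 0) * inl (g 3)
      + inl (g 1) * inl (g 2) + inl (g 1) * inl (g 3) + inl (g 2) * inl (g 3)) * h1
  obtain ⟨eX, eY⟩ := equilibrium_of_last (coupling_comm _ X Y) hX0 hY0 hX1 hY1 hscale
    (hX 0) (hY 0) (hX 1) (hY 1)
  exact snd_eq_zero_of_equilibrium hm0 hm1 hν hs (coupling_comm _ X Y) hC eX eY hX0 hY0 hX1 hY1

end Jets

/-! ### The homogeneous energy and its gradient -/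

section Energy

/-- The Hamiltonian in homogeneous form, `-∑ Γᵢ Γⱼ log rᵢⱼ + (L / 2) log J`. -/
def energy (g x y : Fin 4 → ℝ) : ℝ :=
  -(1 / 2) * pairSum (fun i j => g i * g j * Real.log (sqDist x y i j)) +
    1 / 2 * pairSum (fun i j => g i * g j) *
      Real.log (pairSum fun i j => g i * g j * sqDist x y i j)

/-- The logarithms of the distances contribute `rᵢⱼ⁻²` and `(L / 2) log J` contributes the
multiplier `L / J`; together they form the coupling. -/
theorem hasDerivAt_energy {g x y : Fin 4 → ℝ} (hg : ∀ i, 0 < g i) (u v : Fin 4 → ℝ)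
    (hs : ∀ i j, i ≠ j → 0 < sqDist x y i j) :
    HasDerivAt (fun t : ℝ => energy g (fun i => x i + t * u i) (fun i => y i + t * v i))
      (-pairSum fun i j => coupling g x y i j *
        ((x i - x j) * (u i - u j) + (y i - y j) * (v i - v j))) 0 := by
  have hsq (i j : Fin 4) : HasDerivAt
      (fun t : ℝ => sqDist (fun i => x i + t * u i) (fun i => y i + t * v i) i j)
      (2 * ((x i - x j) * (u i - u j) + (y i - y j) * (v i - v j))) 0 := by
    have h1 (a b : ℝ) : HasDerivAt (fun t : ℝ => a + t * b) b 0 := by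
      simpa using ((hasDerivAt_id (0 : ℝ)).mul_const b).const_add a
    have := (((h1 (x i) (u i)).fun_sub (h1 (x j) (u j))).fun_pow 2).fun_add
      (((h1 (y i) (v i)).fun_sub (h1 (y j) (v j))).fun_pow 2)
    refine this.congr_deriv ?_
    simp
    ring
  have hsq0 (i j : Fin 4) :
      sqDist (fun i => x i + (0 : ℝ) * u i) (fun i => y i + (0 : ℝ) * v i) i j = sqDist x y i j := by
    simp
  have hlog (i j : Fin 4) (h : i ≠ j) := (hsq i j).log (by rw [hsq0]; exact (hs i j h).ne')
  have hsum {φ : Fin 4 → Fin 4 → ℝ → ℝ} {φ' : Fin 4 → Fin 4 → ℝ}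
      (h : ∀ i j, i ≠ j → HasDerivAt (φ i j) (φ' i j) 0) :
      HasDerivAt (fun t => pairSum fun i j => φ i j t) (pairSum φ') 0 :=
    (((((h 0 1 (by decide)).fun_add (h 0 2 (by decide))).fun_add (h 0 3 (by decide))).fun_add
      (h 1 2 (by decide))).fun_add (h 1 3 (by decide))).fun_add (h 2 3 (by decide))
  have hJ : 0 < pairSum fun i j => g i * g j * sqDist x y i j :=
    pairSum_pos fun i j h => mul_pos (mul_pos (hg i) (hg j)) (hs i j h)
  have h1 := (hsum fun i j h => (hlog i j h).const_mul (g i * g j)).const_mul (-(1 / 2))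
  have h2 := ((hsum fun i j _ => (hsq i j).const_mul (g i * g j)).log
    (by simp only [hsq0]; exact hJ.ne')).const_mul (1 / 2 * pairSum fun i j => g i * g j)
  refine (h1.fun_add h2).congr_deriv ?_
  simp only [hsq0]
  have hc : (pairSum fun i j => coupling g x y i j *
        ((x i - x j) * (u i - u j) + (y i - y j) * (v i - v j))) =
      pairSum fun i j => g i * g j * ((sqDist x y i j)⁻¹ - multiplier g x y) *
        ((x i - x j) * (u i - u j) + (y i - y j) * (v i - v j)) :=
    pairSum_congr fun i j h => by rw [coupling, if_neg h]
  rw [hc, multiplier]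
  simp only [div_eq_mul_inv]
  generalize (pairSum fun i j => g i * g j * sqDist x y i j)⁻¹ = w
  simp only [pairSum]
  ring

end Energy

/-! ### Transfer to the manifold through the shape chart -/

section Chart

variable (Γ : Circulations 4)

/-- The variation of the configuration `frame w` in the direction `u`. -/
def frameVariation {k : ℕ} (u : Fin k → ℂ) : Fin (k + 2) → ℂ :=
  Matrix.vecCons 0 (Matrix.vecCons 0 u)

theorem frame_add_smul {k : ℕ} (w u : Fin k → ℂ) (t : ℝ) (i : Fin (k + 2)) :
    frame (w + t • u) i = frame w i + (t : ℂ) * frameVariation u i := by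
  refine Fin.cases ?_ (fun i => Fin.cases ?_ (fun j => ?_) i) i <;>
    simp [frame, frameVariation]

/-- The Hamiltonian in shape coordinates, up to an additive constant. -/
def shapeEnergy (w : Fin 2 → ℂ) : ℝ :=
  energy Γ.val (fun i => (frame w i).re) (fun i => (frame w i).im)

theorem sqDist_re_im (z : Fin 4 → ℂ) (i j : Fin 4) :
    sqDist (fun i => (z i).re) (fun i => (z i).im) i j = ‖z i - z j‖ ^ 2 := by
  rw [Complex.sq_norm, Complex.normSq_apply, sqDist, Complex.sub_re, Complex.sub_im]
  ring

theorem sqDist_frame_pos {w : Fin 2 → ℂ} (hw : w ∈ shapes 2) (i j : Fin 4) (hij : i ≠ j) :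
    0 < sqDist (fun i => (frame w i).re) (fun i => (frame w i).im) i j := by
  rw [sqDist_re_im]
  have : frame w i - frame w j ≠ 0 := fun h => hw ⟨i, j, hij, sub_eq_zero.1 h⟩
  positivity

/-- Lagrange's identity for the second moment about the center of vorticity. It expresses the
impulse by mutual distances, as needed for `energy`. -/
theorem sum_mul_impulse (z : Fin 4 → ℂ) : (∑ i, Γ.val i) * impulse Γ z =
    pairSum fun i j => Γ.val i * Γ.val j * sqDist (fun i => (z i).re) (fun i => (z i).im) i j := by
  have hne : ((∑ i, Γ.val i : ℝ) : ℂ) ≠ 0 := by exact_mod_cast (sum_pos' Γ).ne'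
  have hc : ((∑ i, Γ.val i : ℝ) : ℂ) * center Γ z = ∑ i, (Γ.val i : ℂ) * z i := by
    rw [center, mul_inv_cancel_left₀ hne]
  have hre := congrArg Complex.re hc
  have him := congrArg Complex.im hc
  simp only [impulse, Complex.sq_norm, Complex.normSq_apply, Fin.sum_univ_four, pairSum, sqDist,
    Complex.re_ofReal_mul, Complex.im_ofReal_mul, Complex.sub_re, Complex.sub_im, Complex.add_re,
    Complex.add_im] at hre him ⊢
  generalize (center Γ z).re = a at *
  generalize (center Γ z).im = b at *
  linear_combination ((Γ.val 0 + Γ.val 1 + Γ.val 2 + Γ.val 3) * a - (Γ.val 0 * (z 0).re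
      + Γ.val 1 * (z 1).re + Γ.val 2 * (z 2).re + Γ.val 3 * (z 3).re)) * hre
    + ((Γ.val 0 + Γ.val 1 + Γ.val 2 + Γ.val 3) * b - (Γ.val 0 * (z 0).im
      + Γ.val 1 * (z 1).im + Γ.val 2 * (z 2).im + Γ.val 3 * (z 3).im)) * him

/-- The additive constant between the Hamiltonian and `shapeEnergy`. -/
def energyShift : ℝ :=
  -(1 / 2) * (pairSum fun i j => Γ.val i * Γ.val j) * Real.log (∑ i, Γ.val i)

/-- The representative `rep` rescales `frame w` by `I^(-1/2)`, which adds `½ log I` per pair,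
weighted by `Γᵢ Γⱼ`; by Lagrange's identity `I = J / ∑ Γᵢ`. -/
theorem hamiltonian_rep {w : Fin 2 → ℂ} (hw : w ∈ shapes 2) :
    hamiltonian Γ (rep Γ w) = shapeEnergy Γ w + energyShift Γ := by
  have hI := impulse_frame_pos Γ w
  have hlog (i j : Fin 4) (hij : i ≠ j) : Γ.val i * Γ.val j * Real.log ‖rep Γ w i - rep Γ w j‖ =
      Γ.val i * Γ.val j * (1 / 2 * Real.log (sqDist (fun i => (frame w i).re)
        (fun i => (frame w i).im) i j) - 1 / 2 * Real.log (impulse Γ (frame w))) := by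
    have hne : frame w i - frame w j ≠ 0 := fun h => hw ⟨i, j, hij, sub_eq_zero.1 h⟩
    rw [rep, rep, ← mul_sub, sub_sub_sub_cancel_right, norm_mul, Complex.norm_real, Real.norm_eq_abs,
      abs_of_pos (inv_pos.2 (sqrt_impulse_pos Γ w)),
      Real.log_mul (inv_pos.2 (sqrt_impulse_pos Γ w)).ne' (norm_ne_zero_iff.2 hne),
      Real.log_inv, Real.log_sqrt hI.le, sqDist_re_im, Real.log_pow]
    push_cast
    ring
  have hJ : Real.log (impulse Γ (frame w)) = Real.log (pairSum fun i j => Γ.val i * Γ.val j *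
      sqDist (fun i => (frame w i).re) (fun i => (frame w i).im) i j)
      - Real.log (∑ i, Γ.val i) := by
    rw [← sum_mul_impulse, Real.log_mul (sum_pos' Γ).ne' hI.ne']
    ring
  rw [hamiltonian, sum_Ioi_eq_pairSum, pairSum_congr hlog, hJ, shapeEnergy, energy, energyShift]
  generalize Real.log (pairSum fun i j => Γ.val i * Γ.val j *
      sqDist (fun i => (frame w i).re) (fun i => (frame w i).im) i j) = a
  generalize Real.log (∑ i, Γ.val i) = b
  simp only [pairSum]
  ring

theorem contDiffAt_shapeEnergy {w : Fin 2 → ℂ} (hw : w ∈ shapes 2) :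
    ContDiffAt ℝ ∞ (shapeEnergy Γ) w := by
  have hre (i : Fin 4) : ContDiffAt ℝ ∞ (fun w : Fin 2 → ℂ => (frame w i).re) w :=
    (Complex.reCLM.contDiff.comp (contDiff_frame i)).contDiffAt
  have him (i : Fin 4) : ContDiffAt ℝ ∞ (fun w : Fin 2 → ℂ => (frame w i).im) w :=
    (Complex.imCLM.contDiff.comp (contDiff_frame i)).contDiffAt
  have hsq (i j : Fin 4) : ContDiffAt ℝ ∞ (fun w : Fin 2 → ℂ =>
      sqDist (fun i => (frame w i).re) (fun i => (frame w i).im) i j) w :=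
    (((hre i).sub (hre j)).pow 2).add (((him i).sub (him j)).pow 2)
  have hsum {φ : Fin 4 → Fin 4 → (Fin 2 → ℂ) → ℝ} (h : ∀ i j, i ≠ j → ContDiffAt ℝ ∞ (φ i j) w) :
      ContDiffAt ℝ ∞ (fun w => pairSum fun i j => φ i j w) w :=
    (((((h 0 1 (by decide)).add (h 0 2 (by decide))).add (h 0 3 (by decide))).add
      (h 1 2 (by decide))).add (h 1 3 (by decide))).add (h 2 3 (by decide))
  have hJ : 0 < pairSum fun i j => Γ.val i * Γ.val j *
      sqDist (fun i => (frame w i).re) (fun i => (frame w i).im) i j :=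
    pairSum_pos fun i j h => mul_pos (mul_pos (Γ.pos i) (Γ.pos j)) (sqDist_frame_pos hw i j h)
  exact (contDiffAt_const.mul (hsum fun i j h =>
    contDiffAt_const.mul ((hsq i j).log (sqDist_frame_pos hw i j h).ne'))).add
    (contDiffAt_const.mul ((hsum fun i j _ => contDiffAt_const.mul (hsq i j)).log hJ.ne'))

theorem fderiv_shapeEnergy {w : Fin 2 → ℂ} (hw : w ∈ shapes 2) (u : Fin 2 → ℂ) :
    fderiv ℝ (shapeEnergy Γ) w u = -pairSum fun i j =>
      coupling Γ.val (fun i => (frame w i).re) (fun i => (frame w i).im) i j *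
        (((frame w i).re - (frame w j).re) * ((frameVariation u i).re - (frameVariation u j).re) +
        ((frame w i).im - (frame w j).im) *
          ((frameVariation u i).im - (frameVariation u j).im)) := by
  have h1 := hasDerivAt_energy Γ.pos (fun i => (frameVariation u i).re)
    (fun i => (frameVariation u i).im) (sqDist_frame_pos hw)
  have hd := ((contDiffAt_shapeEnergy Γ hw).differentiableAt (by simp)).hasFDerivAt
  have hline : HasDerivAt (fun t : ℝ => w + t • u) u 0 := by
    simpa using ((hasDerivAt_id (0 : ℝ)).smul_const u).const_add w
  have h2 : HasDerivAt (fun t : ℝ => shapeEnergy Γ (w + t • u)) (fderiv ℝ (shapeEnergy Γ) w u) 0 :=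
    HasFDerivAt.comp_hasDerivAt_of_eq (0 : ℝ) hd hline (by simp)
  refine h2.unique ?_
  refine h1.congr_of_eventuallyEq (Filter.Eventually.of_forall fun t => ?_)
  simp [shapeEnergy, frame_add_smul]

/-- When only vortex `k` moves, only the pairs containing `k` contribute; this identifies the
partial derivatives in the chart with the equilibrium equations of the two free vortices. -/
theorem pairSum_mul_single {C : Fin 4 → Fin 4 → ℝ} (hC : ∀ i j, C i j = C j i) (x : Fin 4 → ℝ)
    {e : Fin 4 → ℝ} {k : Fin 4} (hk : k = 2 ∨ k = 3) (he : e = Pi.single k 1) :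
    (pairSum fun i j => C i j * ((x i - x j) * (e i - e j))) = ∑ j, C k j * (x k - x j) := by
  subst he
  rcases hk with rfl | rfl
  · simp [pairSum, Fin.sum_univ_four, hC 2 0, hC 2 1]
  · simp [pairSum, Fin.sum_univ_four, hC 3 0, hC 3 1, hC 3 2]

theorem fderiv_shapeEnergy_re {w : Fin 2 → ℂ} (hw : w ∈ shapes 2) (k : Fin 2) :
    fderiv ℝ (shapeEnergy Γ) w (Pi.single k 1) = -∑ j,
      coupling Γ.val (fun i => (frame w i).re) (fun i => (frame w i).im) k.succ.succ j *
        ((frame w k.succ.succ).re - (frame w j).re) := by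
  have him (i : Fin 4) : (frameVariation (Pi.single k (1 : ℂ)) i).im = 0 := by
    fin_cases k <;> fin_cases i <;> simp [frameVariation]
  have hre : (fun i : Fin 4 => (frameVariation (Pi.single k (1 : ℂ)) i).re) =
      Pi.single k.succ.succ 1 := by
    funext i
    fin_cases k <;> fin_cases i <;> simp [frameVariation]
  rw [fderiv_shapeEnergy Γ hw, ← pairSum_mul_single (coupling_comm _ _ _)
    (fun i => (frame w i).re) (by fin_cases k <;> simp) hre]
  simp [him]

theorem fderiv_shapeEnergy_im {w : Fin 2 → ℂ} (hw : w ∈ shapes 2) (k : Fin 2) :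
    fderiv ℝ (shapeEnergy Γ) w (Pi.single k Complex.I) = -∑ j,
      coupling Γ.val (fun i => (frame w i).re) (fun i => (frame w i).im) k.succ.succ j *
        ((frame w k.succ.succ).im - (frame w j).im) := by
  have hre (i : Fin 4) : (frameVariation (Pi.single k Complex.I) i).re = 0 := by
    fin_cases k <;> fin_cases i <;> simp [frameVariation]
  have him : (fun i : Fin 4 => (frameVariation (Pi.single k Complex.I) i).im) =
      Pi.single k.succ.succ 1 := by
    funext i
    fin_cases k <;> fin_cases i <;> simp [frameVariation]
  rw [fderiv_shapeEnergy Γ hw, ← pairSum_mul_single (coupling_comm _ _ _)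
    (fun i => (frame w i).im) (by fin_cases k <;> simp) him]
  simp [hre]

open TrivSqZeroExt DualNumber

/-- The critical points of the energy of the vortices `(1, 1, m, m)` are nondegenerate. -/
theorem shapeEnergy_nondegenerate {m : ℝ} (hm0 : 0 < m) (hm1 : m < 1) {w : Fin 2 → ℂ}
    (hw : w ∈ shapes 2) (hcrit : fderiv ℝ (shapeEnergy (pairs m hm0)) w = 0) {v : Fin 2 → ℂ}
    (hv : ∀ u, fderiv ℝ (fderiv ℝ (shapeEnergy (pairs m hm0))) w v u = 0) : v = 0 := by
  set Γ := pairs m hm0 with hΓ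
  have hd : HasFDerivAt (fderiv ℝ (shapeEnergy Γ)) (fderiv ℝ (fderiv ℝ (shapeEnergy Γ)) w) w :=
    (((contDiffAt_shapeEnergy Γ hw).fderiv_right (m := 1) (by norm_cast)).differentiableAt
      (by simp)).hasFDerivAt
  have hline : HasDerivAt (fun t : ℝ => w + t • v) v 0 := by
    simpa using ((hasDerivAt_id (0 : ℝ)).smul_const v).const_add w
  have h2 : HasDerivAt (fun t : ℝ => fderiv ℝ (shapeEnergy Γ) (w + t • v))
      (fderiv ℝ (fderiv ℝ (shapeEnergy Γ)) w v) 0 :=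
    HasFDerivAt.comp_hasDerivAt_of_eq (0 : ℝ) hd hline (by simp)
  -- Along the line through `w` in a kernel direction `v` the gradient is stationary. With `hcrit`,
  -- the gradient equations thus hold to first order.
  have h3 (u : Fin 2 → ℂ) : HasDerivAt (fun t : ℝ => fderiv ℝ (shapeEnergy Γ) (w + t • v) u) 0 0 := by
    have := h2.clm_apply (hasDerivAt_const (0 : ℝ) u)
    simpa [hv u] using this
  have hmem : ∀ᶠ t : ℝ in nhds 0, w + t • v ∈ shapes 2 := by
    have hc : ContinuousAt (fun t : ℝ => w + t • v) 0 := hline.continuousAt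
    exact hc.eventually_mem (isOpen_shapes.mem_nhds (by simpa using hw))
  -- The curve `w + t v` as a point over `ℝ[ε]`; its `ε`-part is `v` at the free vortices and zero
  -- at the two fixed ones.
  obtain ⟨X, hX⟩ : ∃ X : Fin 4 → ℝ[ε], X = fun i =>
    inl (frame w i).re + inr (frameVariation v i).re := ⟨_, rfl⟩
  obtain ⟨Y, hY⟩ : ∃ Y : Fin 4 → ℝ[ε], Y = fun i =>
    inl (frame w i).im + inr (frameVariation v i).im := ⟨_, rfl⟩
  have hlin (a b : ℝ) : HasDerivAt (fun t : ℝ => a + t * b) b 0 := by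
    simpa using ((hasDerivAt_id (0 : ℝ)).mul_const b).const_add a
  have jX (i : Fin 4) : Jet (fun t : ℝ => (frame (w + t • v) i).re) (X i) := by
    simp only [frame_add_smul, Complex.add_re, Complex.re_ofReal_mul, hX]
    exact ⟨by simp, (hlin _ _).congr_deriv (by simp)⟩
  have jY (i : Fin 4) : Jet (fun t : ℝ => (frame (w + t • v) i).im) (Y i) := by
    simp only [frame_add_smul, Complex.add_im, Complex.im_ofReal_mul, hY]
    exact ⟨by simp, (hlin _ _).congr_deriv (by simp)⟩
  have hs (i j : Fin 4) (hij : i ≠ j) : 0 < (sqDist X Y i j).fst := by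
    rw [fst_sqDist]
    have := sqDist_frame_pos hw i j hij
    simpa [hX, hY] using this
  have eX (k : Fin 2) : ∑ j, coupling (fun i => inl (Γ.val i)) X Y k.succ.succ j *
      (X k.succ.succ - X j) = 0 := by
    have hj : Jet (fun t : ℝ => ∑ j, coupling Γ.val (fun i => (frame (w + t • v) i).re)
        (fun i => (frame (w + t • v) i).im) k.succ.succ j *
        ((frame (w + t • v) k.succ.succ).re - (frame (w + t • v) j).re)) _ :=
      Jet.sum (s := Finset.univ) fun j _ =>
        (Jet.coupling Γ.pos jX jY hs k.succ.succ j).mul ((jX k.succ.succ).sub (jX j))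
    refine hj.eq_zero ?_ ?_
    · have := fderiv_shapeEnergy_re Γ hw k
      rw [hcrit] at this
      simpa using this
    · refine ((h3 (Pi.single k 1)).fun_neg.congr_of_eventuallyEq ?_).congr_deriv neg_zero
      filter_upwards [hmem] with t ht
      rw [fderiv_shapeEnergy_re Γ ht k, neg_neg]
  have eY (k : Fin 2) : ∑ j, coupling (fun i => inl (Γ.val i)) X Y k.succ.succ j *
      (Y k.succ.succ - Y j) = 0 := by
    have hj : Jet (fun t : ℝ => ∑ j, coupling Γ.val (fun i => (frame (w + t • v) i).re)
        (fun i => (frame (w + t • v) i).im) k.succ.succ j *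
        ((frame (w + t • v) k.succ.succ).im - (frame (w + t • v) j).im)) _ :=
      Jet.sum (s := Finset.univ) fun j _ =>
        (Jet.coupling Γ.pos jX jY hs k.succ.succ j).mul ((jY k.succ.succ).sub (jY j))
    refine hj.eq_zero ?_ ?_
    · have := fderiv_shapeEnergy_im Γ hw k
      rw [hcrit] at this
      simpa using this
    · refine ((h3 (Pi.single k Complex.I)).fun_neg.congr_of_eventuallyEq ?_).congr_deriv neg_zero
      filter_upwards [hmem] with t ht
      rw [fderiv_shapeEnergy_im Γ ht k, neg_neg]
  have key := snd_eq_zero_of_coupling hm0 hm1 hs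
    (by rw [hX]; ext <;> simp [frame, frameVariation])
    (by rw [hY]; ext <;> simp [frame, frameVariation])
    (by rw [hX]; ext <;> simp [frame, frameVariation])
    (by rw [hY]; ext <;> simp [frame, frameVariation]) eX eY
  funext k
  have := key k.succ.succ
  simp only [hX, hY, snd_add, snd_inl, snd_inr, zero_add] at this
  exact Complex.ext this.1 this.2

theorem reducedHamiltonian_symm {w : Fin 2 → ℂ} (hw : w ∈ shapes 2) :
    reducedHamiltonian Γ ((shapeChart Γ).symm w) = shapeEnergy Γ w + energyShift Γ := by
  have : (shapeChart Γ).symm w = proj Γ ⟨rep Γ w, rep_mem Γ hw⟩ := by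
    change (shapeChart Γ).invFun w = _
    simp only [shapeChart, dif_pos hw]
  rw [this]
  exact hamiltonian_rep Γ hw

theorem shapeChart_mem (p : Reduced Γ) : shapeChart Γ p ∈ shapes 2 :=
  (shapeChart Γ).map_source (Set.mem_univ p)

theorem reducedHamiltonian_eq (p : Reduced Γ) :
    reducedHamiltonian Γ p = shapeEnergy Γ (shapeChart Γ p) + energyShift Γ := by
  rw [← reducedHamiltonian_symm Γ (shapeChart_mem Γ p), (shapeChart Γ).left_inv (Set.mem_univ p)]

theorem contMDiff_reducedHamiltonian :
    ContMDiff 𝓘(ℝ, Fin 2 → ℂ) 𝓘(ℝ, ℝ) ∞ (reducedHamiltonian Γ) := by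
  intro p
  have h1 : ContMDiffAt 𝓘(ℝ, Fin 2 → ℂ) 𝓘(ℝ, Fin 2 → ℂ) ∞ (extChartAt 𝓘(ℝ, Fin 2 → ℂ) p) p :=
    contMDiffAt_extChartAt
  have h2 : ContDiffAt ℝ ∞ (fun w => shapeEnergy Γ w + energyShift Γ)
      (extChartAt 𝓘(ℝ, Fin 2 → ℂ) p p) :=
    (contDiffAt_shapeEnergy Γ (shapeChart_mem Γ p)).add contDiffAt_const
  have h3 := h2.contMDiffAt.comp p h1
  refine h3.congr_of_eventuallyEq (Filter.Eventually.of_forall fun q => ?_)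
  exact reducedHamiltonian_eq Γ q

theorem reducedHamiltonian_comp_symm_eventuallyEq (p : Reduced Γ) :
    reducedHamiltonian Γ ∘ (extChartAt 𝓘(ℝ, Fin 2 → ℂ) p).symm
      =ᶠ[nhds (extChartAt 𝓘(ℝ, Fin 2 → ℂ) p p)] fun w => shapeEnergy Γ w + energyShift Γ := by
  have : shapes 2 ∈ nhds (extChartAt 𝓘(ℝ, Fin 2 → ℂ) p p) :=
    isOpen_shapes.mem_nhds (shapeChart_mem Γ p)
  filter_upwards [this] with w hw
  exact reducedHamiltonian_symm Γ hw

/-- All preferred charts are the one shape chart, and the manifold derivative is the ordinary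
derivative of the function read in it; the additive constant drops out. -/
theorem fderiv_shapeEnergy_eq_zero {p : Reduced Γ}
    (hp : IsCriticalPoint (E := Fin 2 → ℂ) (reducedHamiltonian Γ) p) :
    fderiv ℝ (shapeEnergy Γ) (shapeChart Γ p) = 0 := by
  have hd := (contMDiff_reducedHamiltonian Γ p).mdifferentiableAt (by simp)
  have hp : fderivWithin ℝ (writtenInExtChartAt 𝓘(ℝ, Fin 2 → ℂ) 𝓘(ℝ, ℝ) p (reducedHamiltonian Γ))
      (Set.range 𝓘(ℝ, Fin 2 → ℂ)) (extChartAt 𝓘(ℝ, Fin 2 → ℂ) p p) = 0 :=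
    hd.mfderiv.symm.trans hp
  simp only [writtenInExtChartAt, extChartAt_model_space_eq_id, modelWithCornersSelf_coe,
    Set.range_id, fderivWithin_univ, PartialEquiv.refl_coe, Function.id_comp] at hp
  rw [(reducedHamiltonian_comp_symm_eventuallyEq Γ p).fderiv_eq, fderiv_add_const] at hp
  exact hp

theorem chartHessian_eq (p : Reduced Γ) : chartHessian (reducedHamiltonian Γ) p =
    fderiv ℝ (fderiv ℝ (shapeEnergy Γ)) (shapeChart Γ p) := by
  rw [chartHessian, (reducedHamiltonian_comp_symm_eventuallyEq Γ p).fderiv.fderiv_eq]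
  have : fderiv ℝ (fun w => shapeEnergy Γ w + energyShift Γ) = fderiv ℝ (shapeEnergy Γ) := by
    funext w; exact fderiv_add_const _
  rw [this]
  rfl

end Chart

end Vortex

end

theorem lemma4p5 (m : ℝ) (hm0 : 0 < m) (hm1 : m < 1) :
    Vortex.IsMorse (E := Fin 2 → ℂ) (Vortex.reducedHamiltonian (Vortex.pairs m hm0)) := by
  refine ⟨Vortex.contMDiff_reducedHamiltonian _, fun p hp v hv => ?_⟩
  refine Vortex.shapeEnergy_nondegenerate hm0 hm1 (Vortex.shapeChart_mem _ p)
    (Vortex.fderiv_shapeEnergy_eq_zero _ hp) fun u => ?_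
  rw [← Vortex.chartHessian_eq]
  exact hv u
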